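/- Let $M$ be a simply connected Riemann surface and identify $\mathbb{R}^3=\operatorname{Im}\mathbb{H}$, $S^4=\mathbb{HP}^1$ (the lines in the right vector space $\mathbb{H}^2$), with $x\in\mathbb{H}$ corresponding to the line $(x,1)\mathbb{H}$. For a 1-form $\omega$ on $M$ put $(*\omega)(X)=\omega(iX)$. Let $f\colon M\to\mathbb{R}^3$ be a smooth conformal immersion with Gauss map $N$, so $N^2=-1$ and $*df=N\,df=-df\,N$, and with constant mean curvature $H\neq0$, i.e. $(dN)'=-H\,df$ where $(dN)'=\tfrac12(dN-N{*}dN)$. Assume that $f(M)$ is not contained in a round sphere. *Classical Darboux transforms.* A map $F\colon M\to\mathbb{HP}^1$ is a line subbundle $L_F\subset V=M\times\mathbb{H}^2$ with derivative $\delta_F=\pi d|_{L_F}\in\Omega^1(\mathrm{Hom}(L_F,V/L_F))$. A sphere congruence is a smooth $S\colon M\to\mathrm{End}_{\mathbb{H}}(\mathbb{H}^2)$ with $S^2=-1$; it envelopes $F$ if $SL_F=L_F$ and $*\delta_F=S\delta_F=\delta_FS$. A classical Darboux transform of $f$ is a conformal map $f^\sharp\colon M\to\mathbb{H}$ (smooth,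 $df^\sharp$ has only isolated zeros, and $*df^\sharp=N_1df^\sharp=-df^\sharp N_2$ for smooth $N_1,N_2\colon M\to\mathbb{H}$ with $N_1^2=N_2^2=-1$) such that $f^\sharp(p)\ne f(p)$ for all $p$ and some sphere congruence envelopes both $f$ and $f^\sharp$. A map $f^\sharp\colon M\to\mathbb{R}^3$ of this kind has constant mean curvature if $(dN^\sharp)'=-H^\sharp df^\sharp$ for its smooth Gauss map $N^\sharp$ (with $(N^\sharp)^2=-1$ and $*df^\sharp=N^\sharp df^\sharp=-df^\sharp N^\sharp$) and some constant $H^\sharp\in\mathbb{R}$. *$\mu$-Darboux transforms.* Let $L=L_f$ and $e=(1,0)$, and write sections of $V/L\cong e\mathbb{H}$ as $\varphi=e\alpha$ with $\alpha\colon M\to\mathbb{H}$. For $\mu\in\mathbb{C}\setminus\{0\}$ let $$\nabla^\mu(e\alpha)=e\Big(d\alpha-\tfrac12(dN)'\big(N\alpha\,\tfrac{\mu+\mu^{-1}-2}{2}+\alpha\,\tfrac{\mu^{-1}-\mu}{2}\,i\big)\Big),$$ where complex numbers are regarded as the quaternions $u+iv$. A $\mu$-Darboux transform of $f$ is a map $F\colon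 M\to\mathbb{HP}^1$, $F(p)=\hat\varphi(p)\mathbb{H}$, where $\hat\varphi\colon M\to\mathbb{H}^2$ is the prolongation of a non-trivial $\nabla^\mu$-parallel section $\varphi=e\alpha$ of $V/L$, i.e. the lift with $\hat\varphi\equiv\varphi \bmod L$ and $d\hat\varphi\equiv0\bmod L$. **Statement.** A map $F\colon M\to\mathbb{HP}^1$ is of the form $F=(f^\sharp,1)\mathbb{H}$ with $f^\sharp\colon M\to\mathbb{R}^3$ a classical Darboux transform of $f$ that has constant mean curvature if and only if $F$ is a $\mu$-Darboux transform of $f$ for some $\mu\in\mathbb{R}\setminus\{0,1\}$. -/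

import Mathlib

open scoped Quaternion ContDiff Manifold Topology

noncomputable section

namespace CMCDarboux

/-! ### Calculus on a Riemann surface

`M` is a Riemann surface: a complex manifold modelled on `ℂ`.  Its smooth structure is the underlying
real one, with model `𝓘(ℝ, ℂ)`.  The tangent space at `p` is `ℂ` (read in the preferred chart at `p`),
and its complex structure is multiplication by `Complex.I`. -/

section Calculus

variable {M : Type*} [TopologicalSpace M] [ChartedSpace ℂ M]
variable {E : Type*} [NormedAddCommGroup E] [NormedSpace ℝ E]

/-- Smoothness (over `ℝ`) of a map from `M` into a real normed space. -/
def IsSmooth (f : M → E) : Prop := ContMDiff 𝓘(ℝ, ℂ) 𝓘(ℝ, E) ∞ f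

/-- The differential `df` of a map from `M` into a real normed space. -/
def D (f : M → E) (p : M) : ℂ →L[ℝ] E := mfderiv 𝓘(ℝ, ℂ) 𝓘(ℝ, E) f p

/-- `*df`, where `(*ω)(X) = ω(iX)` is the action of the conformal structure on 1-forms. -/
def starD (f : M → E) (p : M) (X : ℂ) : E := D f p (Complex.I * X)

end Calculus

/-! ### The 4-sphere as the quaternionic projective line -/

/-- `ℍ²`, regarded as a right quaternionic vector space, that is, as a module over `ℍᵐᵒᵖ`. -/
abbrev H2 : Type := ℍ[ℝ] × ℍ[ℝ]

/-- `S⁴ = ℍP¹`, the space of quaternionic lines in the right vector space `ℍ²`. -/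
abbrev HP1 : Type := Projectivization (ℍ[ℝ])ᵐᵒᵖ H2

/-- The affine chart `x ↦ (x, 1)ℍ`, with point at infinity `(1, 0)ℍ`; the 3-space `ℝ³` is the space
of imaginary quaternions. -/
def affine (x : ℍ[ℝ]) : HP1 :=
  Projectivization.mk (ℍ[ℝ])ᵐᵒᵖ ((x, 1) : H2) (fun h => one_ne_zero (congrArg Prod.snd h))

section Surfaces

variable {M : Type*} [TopologicalSpace M] [ChartedSpace ℂ M]

/-- Smooth sections of the line subbundle `L` of the trivial bundle `V = M × ℍ²` which is given by a
map `F : M → ℍP¹`. -/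
def IsSection (F : M → HP1) (σ : M → H2) : Prop :=
  IsSmooth σ ∧ ∀ p, σ p ∈ (F p).submodule

/-- A sphere congruence: a smooth complex structure on the trivial (right) `ℍ²`-bundle.  The oriented
round 2-sphere `S p` consists of the lines fixed by `S p`. -/
structure IsSphereCongruence (S : M → (H2 →ₗ[(ℍ[ℝ])ᵐᵒᵖ] H2)) : Prop where
  smooth : ∀ v, IsSmooth (fun p => S p v)
  sq : ∀ p v, S p (S p v) = -v

/-- `S` envelopes `F : M → ℍP¹`: one has `S L = L` and `*δ = S δ = δ S`, where
`δ = π d|_L ∈ Ω¹(Hom(L, V/L))` is the derivative of `F` and `π : V → V/L` the projection.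
Equalities in `V/L` are written as membership of the difference in `L`. -/
structure Envelopes (S : M → (H2 →ₗ[(ℍ[ℝ])ᵐᵒᵖ] H2)) (F : M → HP1) : Prop where
  map_line : ∀ p, (F p).submodule.map (S p) = (F p).submodule
  star_eq_left : ∀ σ, IsSection F σ → ∀ p X,
    starD σ p X - S p (D σ p X) ∈ (F p).submodule
  left_eq_right : ∀ σ, IsSection F σ → ∀ p X,
    S p (D σ p X) - D (fun q => S q (σ q)) p X ∈ (F p).submodule

/-- Conformal maps `f : M → ℍ = ℝ⁴`, possibly with isolated branch points: `*df = N df = -df R` for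
smooth left and right normals `N`, `R`, and `df` has only isolated zeros. -/
structure IsConformalMap (f : M → ℍ[ℝ]) : Prop where
  smooth : IsSmooth f
  normals : ∃ N R : M → ℍ[ℝ], IsSmooth N ∧ IsSmooth R ∧
    (∀ p, N p * N p = -1) ∧ (∀ p, R p * R p = -1) ∧
    (∀ p X, starD f p X = N p * D f p X) ∧ (∀ p X, starD f p X = -(D f p X * R p))
  isolated : ∀ p, ∀ᶠ q in 𝓝[≠] p, D f q ≠ 0

/-- `fs` is a classical Darboux transform of `f`: a conformal map with `f p ≠ fs p` everywhere such
that some sphere congruence envelopes both `f` and `fs`. -/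
structure IsClassicalDarboux (f fs : M → ℍ[ℝ]) : Prop where
  conformal : IsConformalMap fs
  ne : ∀ p, f p ≠ fs p
  sphere : ∃ S : M → (H2 →ₗ[(ℍ[ℝ])ᵐᵒᵖ] H2), IsSphereCongruence S ∧
    Envelopes S (fun p => affine (f p)) ∧ Envelopes S (fun p => affine (fs p))

/-! ### Surfaces in `ℝ³ = Im ℍ` and mean curvature -/

/-- `N : M → S² ⊂ Im ℍ` is the (smooth) Gauss map of `f : M → Im ℍ`: `N² = -1` and
`*df = N df = -df N`. -/
structure IsGaussMap (f N : M → ℍ[ℝ]) : Prop where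
  smooth : IsSmooth N
  sq : ∀ p, N p * N p = -1
  left : ∀ p X, starD f p X = N p * D f p X
  right : ∀ p X, starD f p X = -(D f p X * N p)

/-- The `(1,0)`-part `(dN)' = (dN - N * dN) / 2` of `dN` with respect to `N`. -/
def dNormalPrime (N : M → ℍ[ℝ]) (p : M) (X : ℂ) : ℍ[ℝ] :=
  (1 / 2 : ℝ) • (D N p X - N p * starD N p X)

/-- The surface `f : M → Im ℍ` with Gauss map `N` has constant mean curvature `H`: `(dN)' = -H df`.
With this normalisation the unit sphere has mean curvature `1` for the inward normal. -/
def HasMeanCurvature (f N : M → ℍ[ℝ]) (H : ℝ) : Prop :=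
  IsGaussMap f N ∧ ∀ p X, dNormalPrime N p X = -(H • D f p X)

/-- A smooth conformal immersion `f : M → ℝ³ = Im ℍ` with Gauss map `N` and constant mean
curvature `H`. -/
structure IsCMCImmersion (f N : M → ℍ[ℝ]) (H : ℝ) : Prop where
  smooth : IsSmooth f
  im : ∀ p, (f p).re = 0
  immersion : ∀ p, Function.Injective (D f p)
  mean : HasMeanCurvature f N H

/-! ### The connections `∇^μ` and the `μ`-Darboux transforms

The splitting `V = L ⊕ eℍ`, `e = (1, 0)`, identifies `V/L` with the trivial bundle `eℍ`.  A section of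
`V/L` is written `φ = e α` with `α : M → ℍ`.  Then `∇φ = e dα`, the complex structure `J` of `V/L` with
`*δ = J δ` is `J φ = e N α`, and `z = u + I v ∈ ℂ` acts by right multiplication, `z φ = φ (u + i v)`. -/

/-- The 1-form `*A`, defined by `(∇J)' = -2 * A`; an endomorphism of `eℍ` is written as a left
multiplication. -/
def starA (N : M → ℍ[ℝ]) (p : M) (X : ℂ) : ℍ[ℝ] := -((1 / 2 : ℝ) • dNormalPrime N p X)

/-- `∇^μ = ∇ + *A (J (μ + μ⁻¹ - 2) / 2 + (μ⁻¹ - μ) / 2 I)`, applied to `φ = e α`. -/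
def nablaMu (N : M → ℍ[ℝ]) (μ : ℂ) (α : M → ℍ[ℝ]) (p : M) (X : ℂ) : ℍ[ℝ] :=
  D α p X + starA N p X *
    (N p * (α p * (((μ + μ⁻¹ - 2) / 2 : ℂ) : ℍ[ℝ])) +
      α p * (((μ⁻¹ - μ) / 2 * Complex.I : ℂ) : ℍ[ℝ]))

/-- A non-trivial `∇^μ`-parallel section `φ = e α` of `V/L`. -/
structure IsParallel (N : M → ℍ[ℝ]) (μ : ℂ) (α : M → ℍ[ℝ]) : Prop where
  smooth : IsSmooth α
  ne_zero : ∃ p, α p ≠ 0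
  parallel : ∀ p X, nablaMu N μ α p X = 0

/-- `φhat` is the prolongation of the section `φ = e α` of `V/L`: a smooth section of `V` with
`π φhat = φ` and `π d φhat = 0`. -/
structure IsProlongation (f : M → ℍ[ℝ]) (α : M → ℍ[ℝ]) (φhat : M → H2) : Prop where
  smooth : IsSmooth φhat
  lift : ∀ p, φhat p - (α p, 0) ∈ (affine (f p)).submodule
  deriv : ∀ p X, D φhat p X ∈ (affine (f p)).submodule

/-- `F : M → S⁴ = ℍP¹` is a `μ`-Darboux transform of the surface `f` with Gauss map `N`:
`F = φhat ℍ` for the prolongation `φhat` of a non-trivial `∇^μ`-parallel section of `V/L`. -/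
def IsMuDarboux (f N : M → ℍ[ℝ]) (μ : ℂ) (F : M → HP1) : Prop :=
  ∃ (α : M → ℍ[ℝ]) (φhat : M → H2), IsParallel N μ α ∧ IsProlongation f α φhat ∧
    ∀ p, ∃ h : φhat p ≠ 0, F p = Projectivization.mk (ℍ[ℝ])ᵐᵒᵖ (φhat p) h

end Surfaces

end CMCDarboux

end

/-! Everything is governed by the parallel surface g = f + N/H. Constant mean curvature of f means
*dg = -N dg, the type opposite to that of df, whence df ∧ dg = dg ∧ df = 0. Transforms are written
f♯ = f + w⁻¹, and both sides of the equivalence reduce to `IsRiccati`: w is imaginary and nowhere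
zero, dw = w df w + ρ dg for a real constant ρ ≠ 0, and the first integral w² + ρ = (ρ/H)(wN + Nw)
holds.

Put a = (μ + μ⁻¹ - 2)/2 and b = (μ⁻¹ - μ)/2. A ∇^μ-parallel α has prolongation (α + fβ, β) with dα =
-df β, and w = βα⁻¹ = (H/2)(aN + b αiα⁻¹). For real μ this is imaginary, and b² = a² + 2a becomes
the first integral with ρ = aH²/2 (`riccati_of_parallel`). Conversely, m = (2/H)w - aN satisfies m²
= -(a² + 2a) and dm = [m, df w]. The flat system dα = -df w α is solved globally (`exists_parallel`)
with mα = bαi at one point; this relation then holds everywhere and says that α is ∇^μ-parallel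
(`IsRiccati.isMuDarboux`).

From the Riccati equation df♯ = -ρ w⁻¹ dg w⁻¹, so f♯ is conformal and branches exactly where g does.
The zeros of dg are those of the holomorphic Hopf differential, hence isolated unless g is constant
and f(M) lies in a round sphere (`isolated_parallel`). By the first integral the normal -w⁻¹Nw of f♯
equals N - (H/ρ)w - Hw⁻¹, whose differential shows that f♯ has mean curvature H again.

Conversely, a common sphere congruence forces wN♯ = -Nw. Differentiating and separating types gives
r(dw - w df w) + H dg = 0 with a real function r (`exists_riccati_coefficient`). Integrability makes
r constant off the zeros of dg, hence everywhere, and a further differentiation forces H♯ = H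
(`meanCurvature_eq`), which yields `riccati_of_darboux`. -/

noncomputable section

set_option linter.unusedSectionVars false

namespace CMCDarboux

/-! ### Differential calculus on a Riemann surface in preferred charts. -/

section ChartCalculus

variable {M : Type*} [TopologicalSpace M] [ChartedSpace ℂ M] [IsManifold 𝓘(ℂ, ℂ) ω M]
variable {E E' : Type*} [NormedAddCommGroup E] [NormedSpace ℝ E] [NormedAddCommGroup E']
  [NormedSpace ℝ E']

instance isManifold_real : IsManifold 𝓘(ℝ, ℂ) ∞ M := by
  refine isManifold_of_contDiffOn 𝓘(ℝ, ℂ) ∞ M fun e e' he he' => ?_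
  have h := (contDiffGroupoid ω 𝓘(ℂ, ℂ)).compatible he he'
  rw [contDiffGroupoid, mem_groupoid_of_pregroupoid] at h
  have h1 := h.1
  simp only [contDiffPregroupoid] at h1
  exact (ContDiffOn.restrict_scalars ℝ h1).of_le le_top

/-- The expression of a map in the preferred chart at `p`. -/
def loc (f : M → E) (p : M) : ℂ → E := f ∘ (chartAt ℂ p).symm

theorem contDiffOn_loc {f : M → E} (hf : IsSmooth f) (p : M) :
    ContDiffOn ℝ ∞ (loc f p) (chartAt ℂ p).target := by
  have h1 := (contMDiffOn_chart_symm (I := 𝓘(ℝ, ℂ)) (n := ∞) (x := p))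
  have h2 := (ContMDiff.comp_contMDiffOn hf h1)
  exact contMDiffOn_iff_contDiffOn.1 h2

theorem contDiffAt_loc {f : M → E} (hf : IsSmooth f) (p : M) {z : ℂ}
    (hz : z ∈ (chartAt ℂ p).target) : ContDiffAt ℝ ∞ (loc f p) z :=
  (contDiffOn_loc hf p).contDiffAt ((chartAt ℂ p).open_target.mem_nhds hz)

theorem differentiableAt_loc {f : M → E} (hf : IsSmooth f) (p : M) {z : ℂ}
    (hz : z ∈ (chartAt ℂ p).target) : DifferentiableAt ℝ (loc f p) z :=
  (contDiffAt_loc hf p hz).differentiableAt (by simp)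

theorem isSmooth_of_contDiffAt_loc {f : M → E}
    (h : ∀ p, ContDiffAt ℝ ∞ (loc f p) (chartAt ℂ p p)) : IsSmooth f := by
  intro p
  have hs := mem_chart_source ℂ p
  have h1 : ContMDiffAt 𝓘(ℝ, ℂ) 𝓘(ℝ, E) ∞ (loc f p ∘ chartAt ℂ p) p :=
    ContMDiffAt.comp p (contMDiffAt_iff_contDiffAt.2 (h p))
      ((contMDiffOn_chart (I := 𝓘(ℝ, ℂ)) (n := ∞) (x := p)).contMDiffAt
        ((chartAt ℂ p).open_source.mem_nhds hs))
  refine h1.congr_of_eventuallyEq ?_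
  filter_upwards [(chartAt ℂ p).open_source.mem_nhds hs] with q hq
  simp [loc, (chartAt ℂ p).left_inv hq]

theorem IsSmooth.continuous {f : M → E} (hf : IsSmooth f) : Continuous f := ContMDiff.continuous hf

theorem IsSmooth.comp_contDiff {f : M → E} {g : E → E'} (hg : ContDiff ℝ ∞ g) (hf : IsSmooth f) :
    IsSmooth (fun p => g (f p)) :=
  hg.contMDiff.comp hf

theorem IsSmooth.prodMk {f : M → E} {g : M → E'} (hf : IsSmooth f) (hg : IsSmooth g) :
    IsSmooth (fun p => (f p, g p)) :=
  ContMDiff.prodMk_space hf hg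

theorem isSmooth_const (c : E) : IsSmooth (fun _ : M => c) := contMDiff_const

theorem D_eq_fderiv_loc {f : M → E} (hf : IsSmooth f) (p : M) :
    D f p = fderiv ℝ (loc f p) (chartAt ℂ p p) := by
  have h : MDifferentiableAt 𝓘(ℝ, ℂ) 𝓘(ℝ, E) f p :=
    (hf p).mdifferentiableAt (by simp)
  rw [D, h.mfderiv]
  simp only [writtenInExtChartAt, loc, fderivWithin_univ, mfld_simps]
  rfl

/-- The complex derivative at `q` of the change from the preferred chart at `q` to the one at
`p`. -/
def transDeriv (p q : M) : ℂ := deriv (chartAt ℂ p ∘ (chartAt ℂ q).symm) (chartAt ℂ q q)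

theorem differentiableAt_transition (p q : M) {x : M} (hp : x ∈ (chartAt ℂ p).source)
    (hq : x ∈ (chartAt ℂ q).source) :
    DifferentiableAt ℂ (chartAt ℂ p ∘ (chartAt ℂ q).symm) (chartAt ℂ q x) := by
  have h := (contDiffGroupoid ω 𝓘(ℂ, ℂ)).compatible (chart_mem_atlas ℂ q) (chart_mem_atlas ℂ p)
  rw [contDiffGroupoid, mem_groupoid_of_pregroupoid] at h
  have h1 := h.1
  simp only [contDiffPregroupoid] at h1
  have h2 : ContDiffOn ℂ ω (chartAt ℂ p ∘ (chartAt ℂ q).symm)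
      ((chartAt ℂ q).symm.trans (chartAt ℂ p)).source := by
    simpa using h1
  refine (h2.contDiffAt ?_).differentiableAt (by simp)
  refine (OpenPartialHomeomorph.open_source _).mem_nhds ?_
  simp [hq, hp]

theorem transDeriv_ne_zero {p q : M} (hq : q ∈ (chartAt ℂ p).source) : transDeriv p q ≠ 0 := by
  have hs := mem_chart_source ℂ q
  have h1 := (differentiableAt_transition p q hq hs).hasDerivAt
  have h2 := (differentiableAt_transition q p hs hq).hasDerivAt
  have e : (chartAt ℂ p ∘ (chartAt ℂ q).symm) (chartAt ℂ q q) = chartAt ℂ p q := by simp [hs]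
  rw [← e] at h2
  have h3 := h2.comp _ h1
  have h4 : ((chartAt ℂ q ∘ (chartAt ℂ p).symm) ∘ (chartAt ℂ p ∘ (chartAt ℂ q).symm))
      =ᶠ[𝓝 (chartAt ℂ q q)] id := by
    have : ((chartAt ℂ q).symm.trans (chartAt ℂ p)).source ∈ 𝓝 (chartAt ℂ q q) :=
      (OpenPartialHomeomorph.open_source _).mem_nhds (by simp [hs, hq])
    filter_upwards [this] with z hz
    simp only [OpenPartialHomeomorph.trans_source, OpenPartialHomeomorph.symm_source,
      Set.mem_inter_iff, Set.mem_preimage] at hz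
    simp [(chartAt ℂ p).left_inv hz.2, (chartAt ℂ q).right_inv hz.1]
  have h5 := (hasDerivAt_id (chartAt ℂ q q)).congr_of_eventuallyEq h4
  have h6 := h3.unique h5
  intro h0
  rw [transDeriv] at h0
  rw [h0, mul_zero] at h6
  exact zero_ne_one h6

/-- Differentials at q are read in the chart preferred at q. Passing to the chart at p multiplies
tangent vectors by a complex number, which commutes with `Complex.I`, so conformal identities
survive the change of chart. -/
theorem D_eq_fderiv_loc_of_mem {f : M → E} (hf : IsSmooth f) {p q : M}
    (hq : q ∈ (chartAt ℂ p).source) (X : ℂ) :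
    D f q X = fderiv ℝ (loc f p) (chartAt ℂ p q) (transDeriv p q * X) := by
  have hs := mem_chart_source ℂ q
  rw [D_eq_fderiv_loc hf]
  have h1 := (differentiableAt_transition p q hq hs).hasDerivAt
  have e : (chartAt ℂ p ∘ (chartAt ℂ q).symm) (chartAt ℂ q q) = chartAt ℂ p q := by simp [hs]
  have h2 := (differentiableAt_loc hf p ((chartAt ℂ p).map_source hq)).hasFDerivAt
  rw [← e] at h2
  have h3 := h2.comp _ (h1.hasFDerivAt.restrictScalars ℝ)
  have h4 : loc f q =ᶠ[𝓝 (chartAt ℂ q q)]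
      (loc f p ∘ (chartAt ℂ p ∘ (chartAt ℂ q).symm)) := by
    have : ((chartAt ℂ q).symm.trans (chartAt ℂ p)).source ∈ 𝓝 (chartAt ℂ q q) :=
      (OpenPartialHomeomorph.open_source _).mem_nhds (by simp [hs, hq])
    filter_upwards [this] with z hz
    simp only [OpenPartialHomeomorph.trans_source, OpenPartialHomeomorph.symm_source,
      Set.mem_inter_iff, Set.mem_preimage] at hz
    simp [loc, (chartAt ℂ p).left_inv hz.2]
  rw [(h3.congr_of_eventuallyEq h4).fderiv, e]
  simp [transDeriv, mul_comm]

/-- Pull back a pointwise identity between differentials to the chart at `p`. -/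
theorem fderiv_loc_eq_D {f : M → E} (hf : IsSmooth f) {p : M} {z : ℂ}
    (hz : z ∈ (chartAt ℂ p).target) (X : ℂ) :
    fderiv ℝ (loc f p) z X =
      D f ((chartAt ℂ p).symm z) ((transDeriv p ((chartAt ℂ p).symm z))⁻¹ * X) := by
  have hq := (chartAt ℂ p).map_target hz
  rw [D_eq_fderiv_loc_of_mem hf hq, (chartAt ℂ p).right_inv hz,
    mul_inv_cancel_left₀ (transDeriv_ne_zero hq)]

theorem hasFDerivAt_loc {f : M → E} (hf : IsSmooth f) (p : M) :
    HasFDerivAt (loc f p) (D f p) (chartAt ℂ p p) := by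
  rw [D_eq_fderiv_loc hf]
  exact (differentiableAt_loc hf p (mem_chart_target ℂ p)).hasFDerivAt

theorem loc_apply_self (f : M → E) (p : M) : loc f p (chartAt ℂ p p) = f p := by
  simp [loc, mem_chart_source]

theorem D_eq_of_hasFDerivAt {f : M → E} (hf : IsSmooth f) {p : M} {f' : ℂ →L[ℝ] E}
    (h : HasFDerivAt (loc f p) f' (chartAt ℂ p p)) : D f p = f' := by
  rw [D_eq_fderiv_loc hf, h.fderiv]

theorem D_const (c : E) (p : M) (X : ℂ) : D (fun _ : M => c) p X = 0 := by
  rw [D_eq_of_hasFDerivAt (isSmooth_const c) (f' := 0) (hasFDerivAt_const c _)]; rfl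

theorem IsSmooth.add {f g : M → E} (hf : IsSmooth f) (hg : IsSmooth g) :
    IsSmooth (fun p => f p + g p) := ContMDiff.add hf hg

theorem IsSmooth.sub {f g : M → E} (hf : IsSmooth f) (hg : IsSmooth g) :
    IsSmooth (fun p => f p - g p) := ContMDiff.sub hf hg

theorem IsSmooth.neg {f : M → E} (hf : IsSmooth f) : IsSmooth (fun p => -f p) := ContMDiff.neg hf

theorem IsSmooth.smul {r : M → ℝ} {f : M → E} (hr : IsSmooth r) (hf : IsSmooth f) :
    IsSmooth (fun p => r p • f p) := ContMDiff.smul hr hf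

theorem IsSmooth.const_smul {f : M → E} (r : ℝ) (hf : IsSmooth f) :
    IsSmooth (fun p => r • f p) := (isSmooth_const r).smul hf

theorem IsSmooth.mul {f g : M → ℍ[ℝ]} (hf : IsSmooth f) (hg : IsSmooth g) :
    IsSmooth (fun p => f p * g p) :=
  (hf.prodMk hg).comp_contDiff (g := fun x : ℍ[ℝ] × ℍ[ℝ] => x.1 * x.2)
    (contDiff_fst.mul contDiff_snd)

theorem IsSmooth.inv {f : M → ℍ[ℝ]} (hf : IsSmooth f) (h0 : ∀ p, f p ≠ 0) :
    IsSmooth (fun p => (f p)⁻¹) := by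
  intro p
  have h : ContDiffAt ℝ ∞ (Inv.inv : ℍ[ℝ] → ℍ[ℝ]) (f p) := by
    simpa only [Ring.inverse_eq_inv'] using! contDiffAt_ringInverse ℝ (Units.mk0 (f p) (h0 p))
  exact h.contMDiffAt.comp p (hf p)

theorem D_add {f g : M → E} (hf : IsSmooth f) (hg : IsSmooth g) (p : M) (X : ℂ) :
    D (fun p => f p + g p) p X = D f p X + D g p X := by
  rw [D_eq_of_hasFDerivAt (hf.add hg) ((hasFDerivAt_loc hf p).add (hasFDerivAt_loc hg p))]; rfl

theorem D_sub {f g : M → E} (hf : IsSmooth f) (hg : IsSmooth g) (p : M) (X : ℂ) :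
    D (fun p => f p - g p) p X = D f p X - D g p X := by
  rw [D_eq_of_hasFDerivAt (hf.sub hg) ((hasFDerivAt_loc hf p).sub (hasFDerivAt_loc hg p))]; rfl

theorem D_neg {f : M → E} (hf : IsSmooth f) (p : M) (X : ℂ) :
    D (fun p => -f p) p X = -D f p X := by
  rw [D_eq_of_hasFDerivAt hf.neg (hasFDerivAt_loc hf p).neg]; rfl

theorem D_smul {r : M → ℝ} {f : M → E} (hr : IsSmooth r) (hf : IsSmooth f) (p : M) (X : ℂ) :
    D (fun p => r p • f p) p X = r p • D f p X + D r p X • f p := by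
  rw [D_eq_of_hasFDerivAt (hr.smul hf) ((hasFDerivAt_loc hr p).smul (hasFDerivAt_loc hf p))]
  simp [loc_apply_self]

theorem D_const_smul {f : M → E} (r : ℝ) (hf : IsSmooth f) (p : M) (X : ℂ) :
    D (fun p => r • f p) p X = r • D f p X := by
  rw [D_smul (isSmooth_const r) hf, D_const]; simp

theorem D_mul {f g : M → ℍ[ℝ]} (hf : IsSmooth f) (hg : IsSmooth g) (p : M) (X : ℂ) :
    D (fun p => f p * g p) p X = f p * D g p X + D f p X * g p := by
  rw [D_eq_of_hasFDerivAt (hf.mul hg) ((hasFDerivAt_loc hf p).mul' (hasFDerivAt_loc hg p))]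
  simp [loc_apply_self]

theorem D_clm {f : M → E} (l : E →L[ℝ] E') (hf : IsSmooth f) (p : M) (X : ℂ) :
    D (fun p => l (f p)) p X = l (D f p X) := by
  rw [D_eq_of_hasFDerivAt (hf.comp_contDiff l.contDiff)
    (l.hasFDerivAt.comp _ (hasFDerivAt_loc hf p))]; rfl

theorem eventually_eq_of_D_eq_zero {f : M → E} (hf : IsSmooth f) {p : M}
    (h : ∀ᶠ q in 𝓝 p, D f q = 0) : ∀ᶠ q in 𝓝 p, f q = f p := by
  set e := chartAt ℂ p
  have hs := mem_chart_source ℂ p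
  have h1 : ∀ᶠ z in 𝓝 (e p), D f (e.symm z) = 0 := by
    have hc := e.continuousAt_symm (e.map_source hs)
    rw [ContinuousAt, e.left_inv hs] at hc
    exact hc.eventually h
  have h2 : ∀ᶠ z in 𝓝 (e p), z ∈ e.target := e.open_target.mem_nhds (e.map_source hs)
  obtain ⟨r, hr, hb⟩ := Metric.eventually_nhds_iff_ball.1 (h1.and h2)
  have h3 : ∀ z ∈ Metric.ball (e p) r, loc f p z = loc f p (e p) := by
    intro z hz
    refine (convex_ball (e p) r).is_const_of_fderivWithin_eq_zero (𝕜 := ℝ)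
      (fun y hy => (differentiableAt_loc hf p (hb y hy).2).differentiableWithinAt)
      (fun y hy => ?_) hz (Metric.mem_ball_self hr)
    rw [fderivWithin_of_isOpen Metric.isOpen_ball hy]
    ext X
    rw [fderiv_loc_eq_D hf (hb y hy).2, (hb y hy).1]
    rfl
  have h4 : ∀ᶠ q in 𝓝 p, e q ∈ Metric.ball (e p) r :=
    (e.continuousAt hs).eventually (Metric.ball_mem_nhds _ hr)
  filter_upwards [h4, e.open_source.mem_nhds hs] with q hq hqs
  have := h3 _ hq
  simpa only [loc, Function.comp, e, (chartAt ℂ p).left_inv hqs, (chartAt ℂ p).left_inv hs]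
    using this

theorem eq_of_D_eq_zero [PreconnectedSpace M] {f : M → E} (hf : IsSmooth f)
    (h : ∀ q, D f q = 0) (p q : M) : f p = f q := by
  have hl : IsLocallyConstant f := (IsLocallyConstant.iff_eventually_eq f).2 fun x =>
    eventually_eq_of_D_eq_zero hf (Filter.Eventually.of_forall h)
  exact hl.apply_eq_of_preconnectedSpace p q

/-- This replaces d² = 0: exterior derivatives are computed by antisymmetrising second derivatives
in one fixed chart. -/
theorem fderiv_fderiv_loc_symm {f : M → E} (hf : IsSmooth f) (p : M) {z : ℂ}
    (hz : z ∈ (chartAt ℂ p).target) (X Y : ℂ) :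
    fderiv ℝ (fderiv ℝ (loc f p)) z X Y = fderiv ℝ (fderiv ℝ (loc f p)) z Y X :=
  ((contDiffAt_loc hf p hz).isSymmSndFDerivAt (by simp; norm_cast)) X Y

theorem contDiffAt_fderiv_loc {f : M → E} (hf : IsSmooth f) (p : M) {z : ℂ}
    (hz : z ∈ (chartAt ℂ p).target) : ContDiffAt ℝ ∞ (fderiv ℝ (loc f p)) z :=
  (contDiffAt_loc hf p hz).fderiv_right (by simp)

theorem hasFDerivAt_fderiv_loc {f : M → E} (hf : IsSmooth f) (p : M) {z : ℂ}
    (hz : z ∈ (chartAt ℂ p).target) (X : ℂ) :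
    HasFDerivAt (fun z => fderiv ℝ (loc f p) z X) ((fderiv ℝ (fderiv ℝ (loc f p)) z).flip X) z := by
  have := ((contDiffAt_fderiv_loc hf p hz).differentiableAt
    (by simp)).hasFDerivAt.clm_apply (hasFDerivAt_const X z)
  refine this.congr_fderiv ?_
  ext1 Y
  simp

end ChartCalculus

/-! ### Gluing local flat frames on a simply connected space. -/

section Monodromy

variable {M : Type*} [TopologicalSpace M] {G : Type*} [DivisionRing G]

/-- The flat bundle glued from local frames `A x` on `U x` whose transition functions
`(A y)⁻¹ * A x` are locally constant. -/
def flatBundle [TopologicalSpace G] [DiscreteTopology G] (U : M → Set M)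
    (A : M → M → G) (hU : ∀ x, IsOpen (U x)) (hx : ∀ x, x ∈ U x)
    (h0 : ∀ x, ∀ q ∈ U x, A x q ≠ 0)
    (hc : ∀ x y q, q ∈ U x → q ∈ U y → ∀ᶠ q' in 𝓝 q, (A y q')⁻¹ * A x q' = (A y q)⁻¹ * A x q) :
    FiberBundleCore M M G where
  baseSet := U
  isOpen_baseSet := hU
  indexAt := id
  mem_baseSet_at := hx
  coordChange x y q v := ((A y q)⁻¹ * A x q * v : G)
  coordChange_self x q hq v := by
    rw [inv_mul_cancel₀ (h0 x q hq), one_mul]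
  continuousOn_coordChange x y := by
    rintro ⟨q, v⟩ ⟨⟨hqx, hqy⟩, -⟩
    refine ContinuousAt.continuousWithinAt ?_
    have h1 : ∀ᶠ p : M × G in 𝓝 (q, v),
        (((A y p.1)⁻¹ * A x p.1 * p.2 : G) : G)
          = ((A y q)⁻¹ * A x q * v : G) := by
      rw [nhds_prod_eq, nhds_discrete G]
      have h2 := (hc x y q hqx hqy).prod_inl (pure v : Filter (G))
      have h3 : ∀ᶠ p : M × G in 𝓝 q ×ˢ (pure v : Filter (G)), p.2 = v :=
        Filter.Eventually.prod_inr (p := fun w => w = v) (by simp) _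
      filter_upwards [h2, h3] with p hp hp'
      rw [hp, hp']
    exact (continuousAt_const (y := ((A y q)⁻¹ * A x q * v : G))).congr
      (h1.mono fun p hp => hp.symm)
  coordChange_comp x y z q hq v := by
    have := h0 y q hq.1.2
    simp only [mul_assoc, mul_inv_cancel_left₀ this]

/-- Local frames with locally constant transition functions on a simply connected space admit a
global flat section with a prescribed value. -/
theorem exists_flat_section [SimplyConnectedSpace M] [LocallyPathConnectedSpace M]
    (U : M → Set M) (A : M → M → G) (hU : ∀ x, IsOpen (U x)) (hx : ∀ x, x ∈ U x)
    (h0 : ∀ x, ∀ q ∈ U x, A x q ≠ 0)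
    (hc : ∀ x y q, q ∈ U x → q ∈ U y → ∀ᶠ q' in 𝓝 q, (A y q')⁻¹ * A x q' = (A y q)⁻¹ * A x q)
    (p₀ : M) (c : G) :
    ∃ α : M → G, α p₀ = c ∧ ∀ x, ∃ k : G, ∀ᶠ q in 𝓝 x, α q = A x q * k := by
  -- With discrete fibres the flat bundle is a covering, so simple connectedness lifts the identity
  -- of `M` to a global section.
  let _ : TopologicalSpace G := ⊥
  have : DiscreteTopology G := ⟨rfl⟩
  let Z := flatBundle U A hU hx h0 hc
  let vec : Z.TotalSpace → G := fun t => t.snd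
  have cov : IsCoveringMap (Bundle.TotalSpace.proj : Bundle.TotalSpace (G) Z.Fiber → M) :=
    FiberBundle.isCoveringMap
  obtain ⟨s, ⟨hs0, hs⟩, -⟩ := cov.existsUnique_continuousMap_lifts (ContinuousMap.id M) p₀
    (⟨p₀, ((A p₀ p₀)⁻¹ * c : G)⟩ : Bundle.TotalSpace (G) Z.Fiber) rfl
  have hproj : ∀ q, (s q).proj = q := fun q => congrFun hs q
  -- The section stores its coefficient in the frame indexed by its own base point. Read in the
  -- fixed trivialisation at x, this coefficient is continuous into a discrete space, hence locally
  -- a constant k.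
  have key : ∀ x, ∃ k : G, ∀ᶠ q in 𝓝 x, A (s q).proj (s q).proj * vec (s q) = A x q * k := by
    intro x
    have hm : s x ∈ (Z.localTriv x).source := by
      rw [Z.mem_localTriv_source, hproj]; exact hx x
    have h1 : ContinuousAt (fun q => (Z.localTriv x (s q)).2) x :=
      continuous_snd.continuousAt.comp
        (((Z.localTriv x).continuousAt hm).comp s.continuous.continuousAt)
    have h2 : ∀ᶠ q in 𝓝 x, (Z.localTriv x (s q)).2 = (Z.localTriv x (s x)).2 := by
      have := h1.eventually (p := fun v => v = (Z.localTriv x (s x)).2)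
      rw [nhds_discrete] at this
      exact this (by simp)
    refine ⟨(Z.localTriv x (s x)).2, ?_⟩
    filter_upwards [h2, (hU x).mem_nhds (hx x)] with q hq hqx
    rw [← hq, Z.localTriv_apply]
    have h3 : q ∈ U x := hqx
    have h4 := h0 x q h3
    have e := hproj q
    change _ = A x q * ((A x (s q).proj)⁻¹ * A (s q).proj (s q).proj * vec (s q))
    generalize (s q).proj = r at *
    subst e
    rw [← mul_assoc, ← mul_assoc, mul_inv_cancel₀ h4, one_mul]
  refine ⟨fun q => A (s q).proj (s q).proj * vec (s q), ?_, key⟩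
  have h1 : ∀ t : Z.TotalSpace, t = ⟨p₀, ((A p₀ p₀)⁻¹ * c : G)⟩ → A t.proj t.proj * vec t = c := by
    rintro t rfl
    exact mul_inv_cancel_left₀ (h0 p₀ p₀ (hx p₀)) c
  exact h1 _ hs0

end Monodromy

/-! ### Local parallel frames of flat connections, by radial transport. -/

section LocalFrame

open Set Metric

variable {V : Type*} [NormedAddCommGroup V] [NormedSpace ℝ V]
variable {A : Type*} [NormedRing A] [NormedAlgebra ℝ A]

/-- Defect of the curve (1 + t b)u as a solution of the transport equation along a ray displaced by
h. Here β and b are the connection on ζ and h, `D1`, `D2`, `D3` are its derivatives in (ζ, h), (h,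
ζ), (h, h), `R` is the Taylor remainder and n = ‖h‖. Flatness cancels all terms of first order in h.
-/
theorem norm_transport_error_le {β b D1 D2 D3 R u : A} {t C K m n : ℝ} (ht0 : 0 ≤ t) (ht1 : t ≤ 1)
    (hn : 0 ≤ n) (hn1 : n ≤ 1) (hC : 0 ≤ C) (hK : 0 ≤ K) (hm : 0 ≤ m)
    (hflat : D1 - D2 + b * β - β * b = 0) (hb : ‖b‖ ≤ C * n) (hD2 : ‖D2‖ ≤ C * n)
    (hD3 : ‖D3‖ ≤ C * n ^ 2) (hR : ‖R‖ ≤ K * n ^ 2) (hu : ‖u‖ ≤ m) :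
    ‖(β * u + (b * u + t • (D1 * u + b * (β * u)))) -
      (β + b + (t • (D2 + D3) + R)) * (u + t • (b * u))‖ ≤
      (2 * C ^ 2 + (C + K) * (1 + C)) * m * n ^ 2 := by
  have e : (β * u + (b * u + t • (D1 * u + b * (β * u)))) -
      (β + b + (t • (D2 + D3) + R)) * (u + t • (b * u)) =
      -(t • (b * (b * u)) + (t • D3 + R) * (u + t • (b * u)) + t • (D2 * (t • (b * u)))) := by
    have h : t • ((D1 - D2 + b * β - β * b) * u) = 0 := by rw [hflat]; simp
    simp only [mul_add, add_mul, sub_mul, mul_assoc, smul_mul_assoc, mul_smul_comm, smul_add,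
      smul_sub] at h ⊢
    linear_combination (norm := module) h
  have hbu : ‖b * u‖ ≤ C * n * m := (norm_mul_le _ _).trans (by gcongr)
  have htbu : ‖t • (b * u)‖ ≤ C * n * m := by
    rw [norm_smul, Real.norm_of_nonneg ht0]
    calc t * ‖b * u‖ ≤ 1 * ‖b * u‖ := by gcongr
      _ ≤ _ := by rw [one_mul]; exact hbu
  have h1 : ‖t • (b * (b * u))‖ ≤ C ^ 2 * m * n ^ 2 := by
    rw [norm_smul, Real.norm_of_nonneg ht0]
    calc t * ‖b * (b * u)‖ ≤ 1 * (‖b‖ * ‖b * u‖) := by gcongr; exact norm_mul_le _ _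
      _ ≤ 1 * ((C * n) * (C * n * m)) := by gcongr
      _ = _ := by ring
  have h2 : ‖t • (D2 * (t • (b * u)))‖ ≤ C ^ 2 * m * n ^ 2 := by
    rw [norm_smul, Real.norm_of_nonneg ht0]
    calc t * ‖D2 * (t • (b * u))‖ ≤ 1 * (‖D2‖ * ‖t • (b * u)‖) := by gcongr; exact norm_mul_le _ _
      _ ≤ 1 * ((C * n) * (C * n * m)) := by gcongr
      _ = _ := by ring
  have h3 : ‖t • D3 + R‖ ≤ (C + K) * n ^ 2 := by
    refine (norm_add_le _ _).trans ?_
    rw [norm_smul, Real.norm_of_nonneg ht0]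
    calc t * ‖D3‖ + ‖R‖ ≤ 1 * (C * n ^ 2) + K * n ^ 2 := by gcongr
      _ = _ := by ring
  have h4 : ‖u + t • (b * u)‖ ≤ (1 + C) * m := by
    refine (norm_add_le _ _).trans ?_
    calc ‖u‖ + ‖t • (b * u)‖ ≤ m + C * n * m := by gcongr
      _ ≤ m + C * 1 * m := by gcongr
      _ = _ := by ring
  rw [e, norm_neg]
  refine (norm_add₃_le).trans ?_
  calc _ ≤ C ^ 2 * m * n ^ 2 + ((C + K) * n ^ 2) * ((1 + C) * m) + C ^ 2 * m * n ^ 2 := by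
        gcongr
        exact (norm_mul_le _ _).trans (by gcongr)
    _ = _ := by ring

theorem exists_radial_transport [CompleteSpace A] [NormOneClass A] {B : V → V →L[ℝ] A}
    {z₀ z : V} {r C : ℝ}
    (hB : ∀ y ∈ ball z₀ r, ContinuousAt B y) (hC : ∀ y ∈ ball z₀ r, ‖B y‖ ≤ C) (hr : 2 * C * r ≤ 1)
    (hz : z ∈ ball z₀ r) :
    ∃ u : ℝ → A, u 0 = 1 ∧ ∀ t ∈ Icc (0 : ℝ) 1,
      HasDerivWithinAt u (B (z₀ + t • (z - z₀)) (z - z₀) * u t) (Icc 0 1) t := by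
  have hr0 : 0 < r := dist_nonneg.trans_lt hz
  have hC0 : 0 ≤ C := (norm_nonneg _).trans (hC z hz)
  have hzr : ‖z - z₀‖ ≤ r := by rw [← dist_eq_norm]; exact hz.le
  have hmem : ∀ t ∈ Icc (0 : ℝ) 1, z₀ + t • (z - z₀) ∈ ball z₀ r := by
    intro t ht
    rw [mem_ball, dist_eq_norm, add_sub_cancel_left, norm_smul, Real.norm_of_nonneg ht.1]
    rw [mem_ball, dist_eq_norm] at hz
    exact (mul_le_of_le_one_left (norm_nonneg _) ht.2).trans_lt hz
  have hb : ∀ t ∈ Icc (0 : ℝ) 1, ‖B (z₀ + t • (z - z₀)) (z - z₀)‖ ≤ C * r := fun t ht =>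
    (ContinuousLinearMap.le_opNorm _ _).trans (by gcongr; exact hC _ (hmem t ht))
  obtain ⟨κ, hκ⟩ : ∃ κ : NNReal, (κ : ℝ) = C * r :=
    ⟨(C * r).toNNReal, Real.coe_toNNReal _ (by positivity)⟩
  rw [← hκ] at hb
  -- On the unit ball around 1 solutions have norm at most 2, so the speed is at most 2κ = 2Cr ≤ 1
  -- and the solution stays in that ball up to time 1.
  have hp : IsPicardLindelof (fun t x => B (z₀ + t • (z - z₀)) (z - z₀) * x)
      (tmin := 0) (tmax := 1) ⟨0, by simp⟩ (1 : A) 1 0 (2 * κ) κ := by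
    refine ⟨fun t ht => ?_, fun x _ => ?_, fun t ht x hx => ?_, ?_⟩
    · refine LipschitzWith.lipschitzOnWith (LipschitzWith.of_dist_le_mul fun x y => ?_)
      rw [dist_eq_norm, dist_eq_norm, ← mul_sub]
      exact (norm_mul_le _ _).trans (by gcongr; exact hb t ht)
    · intro t ht
      have h1 : ContinuousAt (fun t : ℝ => z₀ + t • (z - z₀)) t := by fun_prop
      have h2 : ContinuousAt (fun t : ℝ => B (z₀ + t • (z - z₀))) t :=
        ContinuousAt.comp (g := B) (hB _ (hmem t ht)) h1
      exact ((h2.clm_apply continuousAt_const).mul continuousAt_const).continuousWithinAt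
    · have hx2 : ‖x‖ ≤ 2 := by
        rw [mem_closedBall, dist_eq_norm] at hx
        calc ‖x‖ = ‖(x - 1) + 1‖ := by rw [sub_add_cancel]
          _ ≤ ‖x - 1‖ + ‖(1 : A)‖ := norm_add_le _ _
          _ ≤ 1 + 1 := by gcongr; exacts [by simpa using hx, norm_one.le]
          _ = 2 := by norm_num
      calc ‖B (z₀ + t • (z - z₀)) (z - z₀) * x‖ ≤ κ * 2 :=
            (norm_mul_le _ _).trans (by gcongr; exact hb t ht)
        _ = _ := by push_cast; ring
    · push_cast
      rw [hκ]
      norm_num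
      linarith
  obtain ⟨u, hu0, hu⟩ := hp.exists_eq_forall_mem_Icc_hasDerivWithinAt₀
  exact ⟨u, hu0, hu⟩

/-- A flat connection form on a normed space, with values in left multiplications of a Banach
algebra, has a local parallel frame. -/
theorem exists_local_frame [CompleteSpace A] [NormOneClass A] {B : V → V →L[ℝ] A} {z₀ : V}
    (hB : ContDiffAt ℝ 2 B z₀)
    (hflat : ∀ᶠ z in 𝓝 z₀, ∀ X Y, fderiv ℝ B z X Y - fderiv ℝ B z Y X + B z Y * B z X
      - B z X * B z Y = 0) :
    ∃ u : V → A, u z₀ = 1 ∧ ∀ᶠ z in 𝓝 z₀,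
      HasFDerivAt u (((ContinuousLinearMap.mul ℝ A).flip (u z)).comp (B z)) z := by
  have hd : ∀ᶠ z in 𝓝 z₀, ContDiffAt ℝ 2 B z := hB.eventually (by simp)
  have hB' : ContDiffAt ℝ 1 (fderiv ℝ B) z₀ := hB.fderiv_right (by norm_num)
  obtain ⟨K, s, hs, hK⟩ := hB'.exists_lipschitzOnWith
  have hc1 : ∀ᶠ z in 𝓝 z₀, ‖B z‖ < ‖B z₀‖ + ‖fderiv ℝ B z₀‖ + 1 :=
    hB.continuousAt.norm.eventually_lt continuousAt_const
      (lt_of_le_of_lt (le_add_of_nonneg_right (norm_nonneg (fderiv ℝ B z₀))) (lt_add_one _))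
  have hcn : ContinuousAt (fun z => ‖fderiv ℝ B z‖) z₀ :=
    (continuous_norm (E := V →L[ℝ] V →L[ℝ] A)).continuousAt.comp hB'.continuousAt
  have hc2 : ∀ᶠ z in 𝓝 z₀, ‖fderiv ℝ B z‖ < ‖B z₀‖ + ‖fderiv ℝ B z₀‖ + 1 :=
    hcn.eventually_lt continuousAt_const
      (lt_of_le_of_lt (le_add_of_nonneg_left (norm_nonneg (B z₀))) (lt_add_one _))
  set C := ‖B z₀‖ + ‖fderiv ℝ B z₀‖ + 1 with hCdef
  have hC0 : 0 < C := by positivity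
  obtain ⟨r₀, hr₀, hball⟩ := Metric.eventually_nhds_iff_ball.1
    (hd.and (hflat.and (hc1.and (hc2.and hs))))
  -- The bound 2Cr ≤ 1 serves the Picard theorem and gives the transport equations Lipschitz
  -- constant 1; 2r ≤ 1 keeps every displacement h at norm at most 1.
  obtain ⟨r, hr, hrr₀, hrC, hr2⟩ : ∃ r : ℝ, 0 < r ∧ r ≤ r₀ ∧ 2 * C * r ≤ 1 ∧ 2 * r ≤ 1 := by
    refine ⟨min r₀ (min (1 / (2 * C)) (1 / 2)), by positivity, min_le_left _ _, ?_, ?_⟩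
    · have : min r₀ (min (1 / (2 * C)) (1 / 2)) ≤ 1 / (2 * C) :=
        (min_le_right _ _).trans (min_le_left _ _)
      calc _ ≤ 2 * C * (1 / (2 * C)) := by gcongr
        _ = 1 := by field_simp
    · have : min r₀ (min (1 / (2 * C)) (1 / 2)) ≤ 1 / 2 :=
        (min_le_right _ _).trans (min_le_right _ _)
      linarith
  have hball' : ∀ y ∈ ball z₀ r, _ := fun y hy => hball y (ball_subset_ball hrr₀ hy)
  have hray : ∀ z ∈ ball z₀ r, ∀ t ∈ Icc (0 : ℝ) 1, z₀ + t • (z - z₀) ∈ ball z₀ r := by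
    intro z hz t ht
    rw [mem_ball, dist_eq_norm] at hz ⊢
    rw [add_sub_cancel_left, norm_smul, Real.norm_of_nonneg ht.1]
    exact (mul_le_of_le_one_left (norm_nonneg _) ht.2).trans_lt hz
  have hex : ∀ z : V, ∃ u : ℝ → A, z ∈ ball z₀ r → (u 0 = 1 ∧ ∀ t ∈ Icc (0 : ℝ) 1,
      HasDerivWithinAt u (B (z₀ + t • (z - z₀)) (z - z₀) * u t) (Icc 0 1) t) := by
    intro z
    by_cases hz : z ∈ ball z₀ r
    · obtain ⟨u, hu⟩ := exists_radial_transport (B := B) (z := z) (C := C)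
        (fun y hy => (hball' y hy).1.continuousAt) (fun y hy => (hball' y hy).2.2.1.le) hrC hz
      exact ⟨u, fun _ => hu⟩
    · exact ⟨fun _ => 0, fun h => absurd h hz⟩
  choose u hu using hex
  have hquad : ∀ z ∈ ball z₀ r, ∃ c : ℝ, ∀ h : V, z + h ∈ ball z₀ r →
      ‖u (z + h) 1 - u z 1 - B z h * u z 1‖ ≤ c * ‖h‖ ^ 2 := by
    intro z hz
    obtain ⟨hu0, hu1⟩ := hu z hz
    have hcu : ContinuousOn (u z) (Icc 0 1) := fun t ht => (hu1 t ht).continuousWithinAt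
    obtain ⟨m, hm⟩ := isCompact_Icc.exists_bound_of_continuousOn hcu
    have hm0 : 0 ≤ m := (norm_nonneg _).trans (hm 0 (by simp))
    refine ⟨((2 * C ^ 2 + (C + K) * (1 + C)) * m) * (Real.exp 1 - 1), fun h hzh => ?_⟩
    obtain ⟨hv0, hv1⟩ := hu (z + h) hzh
    have hζ : ‖z - z₀‖ < r := by rwa [← dist_eq_norm]
    have hζh : ‖z + h - z₀‖ < r := by rwa [← dist_eq_norm]
    have hh : ‖h‖ ≤ 1 := by
      calc ‖h‖ = ‖(z + h - z₀) - (z - z₀)‖ := by congr 1; abel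
        _ ≤ ‖z + h - z₀‖ + ‖z - z₀‖ := norm_sub_le _ _
        _ ≤ 1 := by linarith
    set ζ := z - z₀ with hζdef
    -- The comparison curve along the ray to z + h is the first-order guess u + t B(h)u, built from
    -- the solution on the ray to z.
    have hderiv : ∀ t ∈ Icc (0 : ℝ) 1, HasDerivWithinAt
        (fun t => u z t + t • (B (z₀ + t • ζ) h * u z t))
        (B (z₀ + t • ζ) ζ * u z t + (B (z₀ + t • ζ) h * u z t +
          t • (fderiv ℝ B (z₀ + t • ζ) ζ h * u z t +
            B (z₀ + t • ζ) h * (B (z₀ + t • ζ) ζ * u z t)))) (Icc 0 1) t := by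
      intro t ht
      have hP := (hball' _ (hray z hz t ht)).1.differentiableAt (by simp)
      have h1 : HasDerivAt (fun t : ℝ => z₀ + t • ζ) ζ t := by
        simpa using ((hasDerivAt_id t).smul_const ζ).const_add z₀
      have h2 : HasDerivAt (fun t : ℝ => B (z₀ + t • ζ)) (fderiv ℝ B (z₀ + t • ζ) ζ) t :=
        hP.hasFDerivAt.comp_hasDerivAt t h1
      have h3 : HasDerivAt (fun t : ℝ => B (z₀ + t • ζ) h) (fderiv ℝ B (z₀ + t • ζ) ζ h) t := by
        simpa using h2.clm_apply (hasDerivAt_const t h)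
      have h4 := h3.hasDerivWithinAt.mul (hu1 t ht)
      have h5 := (hu1 t ht).add ((hasDerivWithinAt_id t (Icc 0 1)).smul h4)
      refine HasDerivWithinAt.congr_deriv
        (f := fun t => u z t + t • (B (z₀ + t • ζ) h * u z t)) h5 ?_
      simp [add_comm]
    have hv : ∀ t ∈ Icc (0 : ℝ) 1, ‖B (z₀ + t • (z + h - z₀)) (z + h - z₀)‖ ≤ 1 := by
      intro t ht
      calc _ ≤ ‖B (z₀ + t • (z + h - z₀))‖ * ‖z + h - z₀‖ := ContinuousLinearMap.le_opNorm _ _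
        _ ≤ C * r := by gcongr; exact (hball' _ (hray _ hzh t ht)).2.2.1.le
        _ ≤ 1 := by linarith
    have hbound : ∀ t ∈ Icc (0 : ℝ) 1,
        ‖(B (z₀ + t • ζ) ζ * u z t + (B (z₀ + t • ζ) h * u z t +
          t • (fderiv ℝ B (z₀ + t • ζ) ζ h * u z t +
            B (z₀ + t • ζ) h * (B (z₀ + t • ζ) ζ * u z t)))) -
          B (z₀ + t • (z + h - z₀)) (z + h - z₀) *
            (u z t + t • (B (z₀ + t • ζ) h * u z t))‖ ≤
        (2 * C ^ 2 + (C + K) * (1 + C)) * m * ‖h‖ ^ 2 := by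
      intro t ht
      have hP := hball' _ (hray z hz t ht)
      have hQ := hray _ hzh t ht
      set P := z₀ + t • ζ with hPdef
      have hQP : z₀ + t • (z + h - z₀) = P + t • h := by rw [hPdef, hζdef]; module
      have hζh' : z + h - z₀ = ζ + h := by rw [hζdef]; abel
      rw [hQP] at hQ
      rw [hQP, hζh']
      rw [hζh'] at hζh
      have hth : ‖t • h‖ ≤ ‖h‖ := by
        rw [norm_smul, Real.norm_of_nonneg ht.1]
        exact mul_le_of_le_one_left (norm_nonneg _) ht.2
      have hRb : ‖B (P + t • h) - B P - fderiv ℝ B P (t • h)‖ ≤ (K * ‖h‖) * ‖h‖ := by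
        have hseg : segment ℝ P (P + t • h) ⊆ ball z₀ r :=
          (convex_ball z₀ r).segment_subset (hray z hz t ht) hQ
        have h1 := (convex_segment P (P + t • h)).norm_image_sub_le_of_norm_fderiv_le' (𝕜 := ℝ)
          (f := B) (φ := fderiv ℝ B P) (C := K * ‖h‖)
          (fun x hx => (hball' x (hseg hx)).1.differentiableAt (by simp))
          (fun x hx => ?_) (left_mem_segment ℝ _ _) (right_mem_segment ℝ _ _)
        · rw [add_sub_cancel_left] at h1
          exact h1.trans (by gcongr)
        · have h2 := hK.dist_le_mul x (hball' x (hseg hx)).2.2.2.2 P hP.2.2.2.2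
          rw [dist_eq_norm, dist_eq_norm] at h2
          refine h2.trans ?_
          have h3 := norm_sub_le_of_mem_segment hx
          rw [add_sub_cancel_left] at h3
          gcongr
          exact h3.trans hth
      have hsplit : B (P + t • h) (ζ + h) = B P ζ + B P h +
          (t • (fderiv ℝ B P h ζ + fderiv ℝ B P h h) +
            (B (P + t • h) - B P - fderiv ℝ B P (t • h)) (ζ + h)) := by
        simp only [sub_apply, map_add, map_smul, smul_apply]
        module
      rw [hsplit]
      refine norm_transport_error_le ht.1 ht.2 (norm_nonneg _) hh hC0.le K.2 hm0
        (hP.2.1 ζ h) ?_ ?_ ?_ ?_ (hm t ht)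
      · exact (ContinuousLinearMap.le_opNorm _ _).trans (by gcongr; exact hP.2.2.1.le)
      · calc ‖fderiv ℝ B P h ζ‖ ≤ ‖fderiv ℝ B P h‖ * ‖ζ‖ := ContinuousLinearMap.le_opNorm _ _
          _ ≤ (‖fderiv ℝ B P‖ * ‖h‖) * 1 := by
            gcongr
            · exact ContinuousLinearMap.le_opNorm _ _
            · linarith
          _ ≤ (C * ‖h‖) * 1 := by gcongr; exact hP.2.2.2.1.le
          _ = _ := mul_one _
      · calc ‖fderiv ℝ B P h h‖ ≤ ‖fderiv ℝ B P h‖ * ‖h‖ := ContinuousLinearMap.le_opNorm _ _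
          _ ≤ (‖fderiv ℝ B P‖ * ‖h‖) * ‖h‖ := by
            gcongr
            exact ContinuousLinearMap.le_opNorm _ _
          _ ≤ (C * ‖h‖) * ‖h‖ := by gcongr; exact hP.2.2.2.1.le
          _ = _ := by ring
      · calc _ ≤ ‖B (P + t • h) - B P - fderiv ℝ B P (t • h)‖ * ‖ζ + h‖ :=
              ContinuousLinearMap.le_opNorm _ _
          _ ≤ ((K * ‖h‖) * ‖h‖) * 1 := by gcongr; linarith
          _ = _ := by ring
    have hIci : ∀ {w : ℝ → A} {w' : A} {t : ℝ}, t ∈ Ico (0 : ℝ) 1 →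
        HasDerivWithinAt w w' (Icc 0 1) t → HasDerivWithinAt w w' (Ici t) t := fun ht hw =>
      hw.mono_of_mem_nhdsWithin (Icc_mem_nhdsGE_of_mem ht)
    -- Grönwall: the initial values agree and the defect is O(‖h‖²), so at t = 1 the frame differs
    -- from its first-order guess by O(‖h‖²).
    have hg := dist_le_of_approx_trajectories_ODE_of_mem (E := A) (a := 0) (b := 1) (K := 1)
      (v := fun t x => B (z₀ + t • (z + h - z₀)) (z + h - z₀) * x) (s := fun _ => univ)
      (f := u (z + h)) (g := fun t => u z t + t • (B (z₀ + t • ζ) h * u z t)) (δ := 0) (εf := 0)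
      (εg := (2 * C ^ 2 + (C + K) * (1 + C)) * m * ‖h‖ ^ 2)
      (fun t ht => LipschitzWith.lipschitzOnWith (LipschitzWith.of_dist_le_mul fun x y => by
        rw [dist_eq_norm, dist_eq_norm, ← mul_sub]
        exact (norm_mul_le _ _).trans (by gcongr; exact hv t ⟨ht.1, ht.2.le⟩)))
      (fun t ht => (hv1 t ht).continuousWithinAt)
      (fun t ht => hIci ht (hv1 t ⟨ht.1, ht.2.le⟩))
      (fun t ht => by simp) (fun t _ => mem_univ _)
      (fun t ht => (hderiv t ht).continuousWithinAt)
      (fun t ht => hIci ht (hderiv t ⟨ht.1, ht.2.le⟩))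
      (fun t ht => by rw [dist_eq_norm]; exact hbound t ⟨ht.1, ht.2.le⟩) (fun t _ => mem_univ _)
      (by simp [hu0, hv0]) 1 (by simp)
    rw [gronwallBound_of_K_ne_0 (by simp), dist_eq_norm] at hg
    simp only [hζdef, one_smul, add_sub_cancel, NNReal.coe_one, sub_zero, zero_mul, zero_add,
      div_one, mul_one] at hg
    rw [sub_sub]
    exact hg.trans (by rw [mul_right_comm])
  refine ⟨fun z => u z 1, ?_, ?_⟩
  · obtain ⟨hu0, hu1⟩ := hu z₀ (mem_ball_self hr)
    have hcu : ContinuousOn (u z₀) (Icc 0 1) := fun t ht => (hu1 t ht).continuousWithinAt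
    have := constant_of_has_deriv_right_zero hcu
      (fun t ht => (by
        simpa using (hu1 t ⟨ht.1, ht.2.le⟩).mono_of_mem_nhdsWithin (Icc_mem_nhdsGE_of_mem ht)))
      1 (by simp)
    exact this.trans hu0
  · filter_upwards [ball_mem_nhds z₀ hr] with z hz
    obtain ⟨c, hc⟩ := hquad z hz
    rw [hasFDerivAt_iff_isLittleO_nhds_zero]
    refine Asymptotics.IsBigO.trans_isLittleO ?_ (Asymptotics.isLittleO_norm_pow_id one_lt_two)
    refine Asymptotics.IsBigO.of_bound c ?_
    have hnear : ∀ᶠ h in 𝓝 (0 : V), z + h ∈ ball z₀ r := by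
      have hcont : ContinuousAt (fun h : V => z + h) 0 := by fun_prop
      exact hcont.eventually_mem (isOpen_ball.mem_nhds (by simpa using hz))
    filter_upwards [hnear] with h hh
    simpa using hc h hh

end LocalFrame

/-! ### Global solutions of dα = -df w α. -/

section Parallel

/-- The 1-form `-(df) w`, acting by left multiplication, in a chart. -/
def connForm (f w : ℂ → ℍ[ℝ]) (z : ℂ) : ℂ →L[ℝ] ℍ[ℝ] :=
  -((ContinuousLinearMap.mul ℝ ℍ[ℝ]).flip (w z)).comp (fderiv ℝ f z)

theorem connForm_apply (f w : ℂ → ℍ[ℝ]) (z X : ℂ) :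
    connForm f w z X = -(fderiv ℝ f z X * w z) := rfl

/-- `u` satisfies `du = -df w u` at `z`. -/
def IsParallelAt (f w u : ℂ → ℍ[ℝ]) (z : ℂ) : Prop :=
  HasFDerivAt u (((ContinuousLinearMap.mul ℝ ℍ[ℝ]).flip (u z)).comp (connForm f w z)) z

theorem differentiableAt_quaternion_inv {V : Type*} [NormedAddCommGroup V] [NormedSpace ℝ V]
    {b : V → ℍ[ℝ]} {z : V} (hb : DifferentiableAt ℝ b z) (h0 : b z ≠ 0) :
    DifferentiableAt ℝ (fun z => (b z)⁻¹) z := by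
  have h : ContDiffAt ℝ 1 (Inv.inv : ℍ[ℝ] → ℍ[ℝ]) (b z) := by
    simpa only [Ring.inverse_eq_inv'] using! contDiffAt_ringInverse ℝ (Units.mk0 (b z) h0)
  exact (h.differentiableAt (by simp)).comp z hb

/-- The connection acts from the left, so two solutions differ by a constant right factor.
Differentiating b(b⁻¹a) = a avoids the derivative of the inverse. -/
theorem ratio_eq_of_isParallelAt {f w a b : ℂ → ℍ[ℝ]} {s : Set ℂ} (hs : Convex ℝ s)
    (hso : IsOpen s) (ha : ∀ z ∈ s, IsParallelAt f w a z) (hb : ∀ z ∈ s, IsParallelAt f w b z)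
    (h0 : ∀ z ∈ s, b z ≠ 0) {z z' : ℂ} (hz : z ∈ s) (hz' : z' ∈ s) :
    (b z)⁻¹ * a z = (b z')⁻¹ * a z' := by
  have hd : ∀ z ∈ s, DifferentiableAt ℝ (fun z => (b z)⁻¹ * a z) z := fun z hz =>
    (differentiableAt_quaternion_inv (hb z hz).differentiableAt (h0 z hz)).mul
      (ha z hz).differentiableAt
  refine hs.is_const_of_fderivWithin_eq_zero (𝕜 := ℝ)
    (fun y hy => (hd y hy).differentiableWithinAt) (fun y hy => ?_) hz hz'
  rw [fderivWithin_of_isOpen hso hy]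
  have h1 := (hb y hy).mul' (hd y hy).hasFDerivAt
  have h2 : HasFDerivAt (fun z => b z * ((b z)⁻¹ * a z)) _ y := h1
  have h3 : (fun z => b z * ((b z)⁻¹ * a z)) =ᶠ[𝓝 y] a := by
    filter_upwards [hso.mem_nhds hy] with x hx
    rw [mul_inv_cancel_left₀ (h0 x hx)]
  have h4 := (h2.congr_of_eventuallyEq h3.symm).unique (ha y hy)
  ext1 X
  have h5 := DFunLike.congr_fun h4 X
  simp only [add_apply, smul_apply, ContinuousLinearMap.comp_apply, ContinuousLinearMap.flip_apply,
    ContinuousLinearMap.mul_apply', smul_eq_mul, MulOpposite.smul_eq_mul_unop,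
    MulOpposite.unop_op] at h5
  rw [mul_assoc, mul_inv_cancel_left₀ (h0 y hy), add_eq_right] at h5
  exact (mul_eq_zero.1 h5).resolve_left (h0 y hy)

/-- Bootstrapping: the equation expresses the derivative of u through u and smooth data, which gains
one order at a time. -/
theorem contDiffOn_of_isParallelAt {f w u : ℂ → ℍ[ℝ]} {s : Set ℂ} (hso : IsOpen s)
    (hf : ContDiffOn ℝ ∞ f s) (hw : ContDiffOn ℝ ∞ w s) (hu : ∀ z ∈ s, IsParallelAt f w u z) :
    ContDiffOn ℝ ∞ u s := by
  have hB : ContDiffOn ℝ ∞ (connForm f w) s := by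
    refine ContDiffOn.neg (ContDiffOn.clm_comp ?_ (hf.fderiv_of_isOpen hso (by simp)))
    exact (ContinuousLinearMap.mul ℝ ℍ[ℝ]).flip.contDiff.comp_contDiffOn hw
  refine contDiffOn_infty.2 fun n => ?_
  induction n with
  | zero => exact contDiffOn_zero.2 fun z hz => (hu z hz).continuousAt.continuousWithinAt
  | succ n ih =>
    have := (contDiffOn_succ_iff_fderiv_of_isOpen (𝕜 := ℝ) (f := u) (n := n) hso).2
      ⟨fun z hz => (hu z hz).differentiableAt.differentiableWithinAt, by simp, ?_⟩
    · exact_mod_cast this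
    · have h1 : ContDiffOn ℝ n
          (fun z => ((ContinuousLinearMap.mul ℝ ℍ[ℝ]).flip (u z)).comp (connForm f w z)) s :=
        ContDiffOn.clm_comp ((ContinuousLinearMap.mul ℝ ℍ[ℝ]).flip.contDiff.comp_contDiffOn ih)
          (hB.of_le (by exact_mod_cast le_top))
      exact h1.congr fun z hz => (hu z hz).fderiv

variable {M : Type*} [TopologicalSpace M] [ChartedSpace ℂ M] [IsManifold 𝓘(ℂ, ℂ) ω M]

/-- Global solutions of the flat system `dα = -df w α` on a simply connected surface. -/
theorem exists_parallel [SimplyConnectedSpace M] {f w : M → ℍ[ℝ]} (hf : IsSmooth f)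
    (hw : IsSmooth w)
    (hflat : ∀ p X Y, D f p X * D w p Y - D f p Y * D w p X
      + D f p Y * w p * (D f p X * w p) - D f p X * w p * (D f p Y * w p) = 0)
    (p₀ : M) (c : ℍ[ℝ]) :
    ∃ α : M → ℍ[ℝ], IsSmooth α ∧ α p₀ = c ∧ (c ≠ 0 → ∀ p, α p ≠ 0) ∧
      ∀ p X, D α p X = -(D f p X * w p * α p) := by
  have hlpc : LocallyPathConnectedSpace M := ChartedSpace.locallyPathConnectedSpace ℂ M
  have hloc : ∀ x : M, ∃ u : ℂ → ℍ[ℝ], ∃ O : Set ℂ, IsOpen O ∧ chartAt ℂ x x ∈ O ∧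
      O ⊆ (chartAt ℂ x).target ∧ ∀ z ∈ O, IsParallelAt (loc f x) (loc w x) u z ∧ u z ≠ 0 := by
    intro x
    have htx := mem_chart_target ℂ x
    have ht : ∀ᶠ z in 𝓝 (chartAt ℂ x x), z ∈ (chartAt ℂ x).target :=
      (chartAt ℂ x).open_target.mem_nhds htx
    have hB : ∀ z ∈ (chartAt ℂ x).target, ContDiffAt ℝ ∞ (connForm (loc f x) (loc w x)) z := by
      intro z hz
      refine ContDiffAt.neg (ContDiffAt.clm_comp ?_ (contDiffAt_fderiv_loc hf x hz))
      exact (ContinuousLinearMap.mul ℝ ℍ[ℝ]).flip.contDiff.contDiffAt.comp z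
        (contDiffAt_loc hw x hz)
    obtain ⟨u, hu0, hu⟩ := exists_local_frame (B := connForm (loc f x) (loc w x))
      (z₀ := chartAt ℂ x x) ((hB _ htx).of_le (by norm_cast)) (by
        filter_upwards [ht] with z hz X Y
        have hD : ∀ X Y, fderiv ℝ (connForm (loc f x) (loc w x)) z X Y =
            -(fderiv ℝ (fderiv ℝ (loc f x)) z X Y * loc w x z +
              fderiv ℝ (loc f x) z Y * fderiv ℝ (loc w x) z X) := by
          intro X Y
          have h1 := ((contDiffAt_fderiv_loc hf x hz).differentiableAt (by simp)).hasFDerivAt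
          have h2 := (differentiableAt_loc hw x hz).hasFDerivAt
          have h3 := ((h1.clm_apply (hasFDerivAt_const Y z)).mul' h2).neg
          have h4 := (((hB z hz).differentiableAt (by simp)).hasFDerivAt.clm_apply
            (hasFDerivAt_const Y z))
          have h5 := h4.unique h3
          have h6 := DFunLike.congr_fun h5 X
          simpa [add_comm] using h6
        have hfl := hflat ((chartAt ℂ x).symm z)
          ((transDeriv x ((chartAt ℂ x).symm z))⁻¹ * X)
          ((transDeriv x ((chartAt ℂ x).symm z))⁻¹ * Y)
        rw [← fderiv_loc_eq_D hf hz, ← fderiv_loc_eq_D hf hz, ← fderiv_loc_eq_D hw hz,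
          ← fderiv_loc_eq_D hw hz] at hfl
        rw [hD, hD, fderiv_fderiv_loc_symm hf x hz Y X]
        simp only [connForm_apply]
        rw [← hfl]
        simp only [loc, Function.comp]
        noncomm_ring)
    have h0 : ∀ᶠ z in 𝓝 (chartAt ℂ x x), u z ≠ 0 :=
      (hu.self_of_nhds).continuousAt.eventually_ne (by rw [hu0]; exact one_ne_zero)
    obtain ⟨O, hO, hOo, hxO⟩ := eventually_nhds_iff.1 (ht.and (hu.and h0))
    exact ⟨u, O, hOo, hxO, fun z hz => (hO z hz).1, fun z hz => (hO z hz).2⟩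
  choose u O hO hxO hOt hu using hloc
  have hsrc : ∀ x, (chartAt ℂ x).source ∩ chartAt ℂ x ⁻¹' O x ⊆ (chartAt ℂ x).source :=
    fun x => Set.inter_subset_left
  obtain ⟨α, hα0, hα⟩ := exists_flat_section
    (fun x => (chartAt ℂ x).source ∩ chartAt ℂ x ⁻¹' O x) (fun x q => u x (chartAt ℂ x q))
    (fun x => (chartAt ℂ x).isOpen_inter_preimage (hO x)) (fun x => ⟨mem_chart_source ℂ x, hxO x⟩)
    (fun x q hq => (hu x _ hq.2).2) (by
      intro x y q hqx hqy
      set τ := chartAt ℂ y ∘ (chartAt ℂ x).symm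
      have hnear : ∀ᶠ z in 𝓝 (chartAt ℂ x q), z ∈ O x ∧
          (chartAt ℂ x).symm z ∈ (chartAt ℂ y).source ∩ chartAt ℂ y ⁻¹' O y := by
        refine Filter.Eventually.and ((hO x).mem_nhds hqx.2) ?_
        have h1 := (chartAt ℂ x).continuousAt_symm ((chartAt ℂ x).map_source hqx.1)
        rw [ContinuousAt, (chartAt ℂ x).left_inv hqx.1] at h1
        exact h1.eventually_mem (((chartAt ℂ y).isOpen_inter_preimage (hO y)).mem_nhds hqy)
      obtain ⟨r, hr, hball⟩ := Metric.eventually_nhds_iff_ball.1 hnear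
      -- The system is invariant under change of chart: the frame of chart y, pulled back by the
      -- transition map, solves the system in chart x.
      have hpar : ∀ z ∈ Metric.ball (chartAt ℂ x q) r,
          IsParallelAt (loc f x) (loc w x) (fun z => u y (τ z)) z := by
        intro z hz
        obtain ⟨hzx, hzy, hzO⟩ := hball z hz
        have hzt := hOt x hzx
        have h1 : DifferentiableAt ℝ τ z := by
          have := differentiableAt_transition y x hzy ((chartAt ℂ x).map_target hzt)
          rw [(chartAt ℂ x).right_inv hzt] at this
          exact this.restrictScalars ℝ
        have h2 : HasFDerivAt (fun z => u y (τ z)) _ z := (hu y (τ z) hzO).1.comp z h1.hasFDerivAt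
        have hτ : ∀ (g : M → ℍ[ℝ]), loc g x =ᶠ[𝓝 z] loc g y ∘ τ := by
          intro g
          filter_upwards [Metric.isOpen_ball.mem_nhds hz] with z' hz'
          simp only [loc, τ, Function.comp, (chartAt ℂ y).left_inv (hball z' hz').2.1]
        have h3 : fderiv ℝ (loc f x) z = (fderiv ℝ (loc f y) (τ z)).comp (fderiv ℝ τ z) := by
          rw [(hτ f).fderiv_eq]
          exact fderiv_comp z (differentiableAt_loc hf y ((chartAt ℂ y).map_source hzy)) h1
        have h4 : loc w x z = loc w y (τ z) := (hτ w).self_of_nhds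
        refine h2.congr_fderiv ?_
        ext1 X
        simp only [ContinuousLinearMap.comp_apply, ContinuousLinearMap.flip_apply,
          ContinuousLinearMap.mul_apply', connForm_apply, h3, h4]
      have hcc : ContinuousAt (chartAt ℂ x) q := (chartAt ℂ x).continuousAt hqx.1
      filter_upwards [hcc.eventually_mem (Metric.ball_mem_nhds _ hr),
        (chartAt ℂ x).open_source.mem_nhds hqx.1] with q' hq' hq's
      have := ratio_eq_of_isParallelAt (convex_ball _ r) Metric.isOpen_ball
        (fun z hz => (hu x z (hball z hz).1).1) hpar (fun z hz => (hu y _ (hball z hz).2.2).2)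
        hq' (Metric.mem_ball_self hr)
      simpa only [τ, Function.comp, (chartAt ℂ x).left_inv hq's, (chartAt ℂ x).left_inv hqx.1]
        using this)
    p₀ c
  have hlocα : ∀ x, ∃ k : ℍ[ℝ], loc α x =ᶠ[𝓝 (chartAt ℂ x x)] fun z => u x z * k := by
    intro x
    obtain ⟨k, hk⟩ := hα x
    refine ⟨k, ?_⟩
    have hs := mem_chart_source ℂ x
    have h1 := (chartAt ℂ x).continuousAt_symm (mem_chart_target ℂ x)
    rw [ContinuousAt, (chartAt ℂ x).left_inv hs] at h1
    filter_upwards [h1.eventually hk, (hO x).mem_nhds (hxO x)] with z hz hzO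
    rw [loc, Function.comp, hz, (chartAt ℂ x).right_inv (hOt x hzO)]
  have hαs : IsSmooth α := by
    refine isSmooth_of_contDiffAt_loc fun x => ?_
    obtain ⟨k, hk⟩ := hlocα x
    have h1 := contDiffOn_of_isParallelAt (hO x) ((contDiffOn_loc hf x).mono (hOt x))
      ((contDiffOn_loc hw x).mono (hOt x)) (fun z hz => (hu x z hz).1)
    exact ((h1.contDiffAt ((hO x).mem_nhds (hxO x))).mul contDiffAt_const).congr_of_eventuallyEq hk
  -- Local frames are invertible, so vanishing of α is decided locally by its constant coefficient
  -- k; connectedness spreads nonvanishing from p₀.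
  have hlc : IsLocallyConstant (fun q => α q = 0) := by
    refine (IsLocallyConstant.iff_eventually_eq _).2 fun x => ?_
    obtain ⟨k, hk⟩ := hα x
    have hev : ∀ᶠ q in 𝓝 x, (α q = 0) = (k = 0) := by
      filter_upwards [hk, ((chartAt ℂ x).isOpen_inter_preimage (hO x)).mem_nhds
        ⟨mem_chart_source ℂ x, hxO x⟩] with q hq hqO
      rw [hq, mul_eq_zero, or_iff_right (hu x _ hqO.2).2]
    filter_upwards [hev] with q hq
    rw [hq, hev.self_of_nhds]
  refine ⟨α, hαs, hα0, fun hc p hp => hc ?_, fun x X => ?_⟩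
  · rw [← hα0]
    exact (hlc.apply_eq_of_preconnectedSpace p p₀).mp hp
  obtain ⟨k, hk⟩ := hlocα x
  have h1 := ((hu x _ (hxO x)).1.mul' (hasFDerivAt_const k _)).congr_of_eventuallyEq hk
  have h2 : α x = u x (chartAt ℂ x x) * k := by
    rw [← loc_apply_self α x]; exact hk.self_of_nhds
  rw [D_eq_of_hasFDerivAt hαs h1, D_eq_fderiv_loc hf, h2]
  simp [connForm_apply, loc_apply_self, mul_assoc]

end Parallel

/-! ### Imaginary quaternions. -/

section Algebra

theorem re_eq_zero_of_sq {n : ℍ[ℝ]} (h : n * n = -1) : n.re = 0 := by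
  have h0 := congrArg QuaternionAlgebra.re h
  have h1 := congrArg QuaternionAlgebra.imI h
  have h2 := congrArg QuaternionAlgebra.imJ h
  have h3 := congrArg QuaternionAlgebra.imK h
  simp at h0 h1 h2 h3
  by_contra hne
  have e1 : n.imI = 0 := by
    have : n.re * n.imI = 0 := by linarith
    exact (mul_eq_zero.1 this).resolve_left hne
  have e2 : n.imJ = 0 := by
    have : n.re * n.imJ = 0 := by linarith
    exact (mul_eq_zero.1 this).resolve_left hne
  have e3 : n.imK = 0 := by
    have : n.re * n.imK = 0 := by linarith
    exact (mul_eq_zero.1 this).resolve_left hne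
  rw [e1, e2, e3] at h0
  nlinarith [mul_self_nonneg n.re]

theorem re_mul_comm (a b : ℍ[ℝ]) : (a * b).re = (b * a).re := by simp; ring

/-- Since x = n x n, cyclicity of the real part gives Re x = Re(x n²) = -Re x. -/
theorem re_eq_zero_of_anticomm {n x : ℍ[ℝ]} (h : n * n = -1) (hx : n * x = -(x * n)) :
    x.re = 0 := by
  have h1 : x = n * (x * n) := by
    rw [← mul_assoc, hx, neg_mul, mul_assoc, h]; simp
  have h2 := congrArg QuaternionAlgebra.re h1
  rw [re_mul_comm, mul_assoc, h] at h2
  simp at h2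
  linarith

theorem star_eq_neg_of_re {x : ℍ[ℝ]} (h : x.re = 0) : star x = -x := by
  rw [Quaternion.star_eq_neg]; exact h

theorem mul_self_eq_coe_of_re {x : ℍ[ℝ]} (h : x.re = 0) : x * x = ((-‖x‖ ^ 2 : ℝ) : ℍ[ℝ]) := by
  have h1 := Quaternion.self_mul_star x
  rw [star_eq_neg_of_re h, Quaternion.normSq_eq_norm_mul_self] at h1
  rw [← neg_neg (x * x), ← mul_neg, h1]
  push_cast
  rw [sq]

end Algebra

/-! ### The parallel surface and its branch points. -/

section Surface

variable {M : Type*} [TopologicalSpace M] [ChartedSpace ℂ M] [IsManifold 𝓘(ℂ, ℂ) ω M]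
variable {f N : M → ℍ[ℝ]} {H : ℝ}

/-- The parallel constant mean curvature surface `g = f + N / H`. -/
def parallelSurface (f N : M → ℍ[ℝ]) (H : ℝ) (p : M) : ℍ[ℝ] := f p + H⁻¹ • N p

namespace IsCMCImmersion

theorem smoothN (hf : IsCMCImmersion f N H) : IsSmooth N := hf.mean.1.smooth

theorem sqN (hf : IsCMCImmersion f N H) (p : M) : N p * N p = -1 := hf.mean.1.sq p

theorem reN (hf : IsCMCImmersion f N H) (p : M) : (N p).re = 0 := re_eq_zero_of_sq (hf.sqN p)

theorem D_I (hf : IsCMCImmersion f N H) (p : M) (X : ℂ) :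
    D f p (Complex.I * X) = N p * D f p X := hf.mean.1.left p X

theorem anticomm (hf : IsCMCImmersion f N H) (p : M) (X : ℂ) :
    N p * D f p X = -(D f p X * N p) := (hf.mean.1.left p X).symm.trans (hf.mean.1.right p X)

theorem D_ne_zero (hf : IsCMCImmersion f N H) (p : M) {X : ℂ} (hX : X ≠ 0) : D f p X ≠ 0 :=
  fun h => hX (hf.immersion p (by rw [h, map_zero]))

theorem smooth_parallel (hf : IsCMCImmersion f N H) : IsSmooth (parallelSurface f N H) :=
  hf.smooth.add (hf.smoothN.const_smul _)

theorem D_parallel (hf : IsCMCImmersion f N H) (p : M) (X : ℂ) :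
    D (parallelSurface f N H) p X = D f p X + H⁻¹ • D N p X := by
  have := D_add hf.smooth (hf.smoothN.const_smul H⁻¹) p X
  rw [D_const_smul _ hf.smoothN] at this
  exact this

theorem D_normal (hf : IsCMCImmersion f N H) (hH : H ≠ 0) (p : M) (X : ℂ) :
    D N p X = H • D (parallelSurface f N H) p X - H • D f p X := by
  rw [hf.D_parallel, smul_add, smul_inv_smul₀ hH]; abel

/-- The relation (dN)' = -H df says that H dg = H df + dN has no (1,0)-part with respect to N. -/
theorem D_parallel_I (hf : IsCMCImmersion f N H) (hH : H ≠ 0) (p : M) (X : ℂ) :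
    D (parallelSurface f N H) p (Complex.I * X) = -(N p * D (parallelSurface f N H) p X) := by
  have h1 := hf.mean.2 p X
  rw [dNormalPrime, starD, hf.D_normal hH, hf.D_normal hH, hf.D_I] at h1
  have h2 : N p * (N p * D f p X) = -D f p X := by rw [← mul_assoc, hf.sqN]; simp
  simp only [mul_sub, mul_smul_comm, h2] at h1
  have h3 : H • (D (parallelSurface f N H) p X
      - N p * D (parallelSurface f N H) p (Complex.I * X)) = 0 := by
    linear_combination (norm := module) (2 : ℝ) • h1
  have h4 := sub_eq_zero.1 ((smul_eq_zero.1 h3).resolve_left hH)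
  rw [h4, ← mul_assoc, hf.sqN]; simp

theorem anticomm_D_normal (hf : IsCMCImmersion f N H) (p : M) (X : ℂ) :
    N p * D N p X = -(D N p X * N p) := by
  have h1 := D_mul hf.smoothN hf.smoothN p X
  have h2 : (fun p => N p * N p) = fun _ => (-1 : ℍ[ℝ]) := funext hf.sqN
  rw [h2, D_const] at h1
  exact eq_neg_of_add_eq_zero_left h1.symm

theorem anticomm_parallel (hf : IsCMCImmersion f N H) (p : M) (X : ℂ) :
    N p * D (parallelSurface f N H) p X = -(D (parallelSurface f N H) p X * N p) := by
  rw [hf.D_parallel, mul_add, add_mul, mul_smul_comm, smul_mul_assoc, hf.anticomm,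
    hf.anticomm_D_normal]
  module

theorem re_D (hf : IsCMCImmersion f N H) (p : M) (X : ℂ) : (D f p X).re = 0 :=
  re_eq_zero_of_anticomm (hf.sqN p) (hf.anticomm p X)

theorem re_D_parallel (hf : IsCMCImmersion f N H) (p : M) (X : ℂ) :
    (D (parallelSurface f N H) p X).re = 0 :=
  re_eq_zero_of_anticomm (hf.sqN p) (hf.anticomm_parallel p X)

/-- `df ∧ dg = 0`. -/
theorem D_wedge_parallel (hf : IsCMCImmersion f N H) (hH : H ≠ 0) (p : M) (X Y : ℂ) :
    D f p X * D (parallelSurface f N H) p Y = D f p Y * D (parallelSurface f N H) p X := by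
  -- For X = x + iy one has df(X) = df(1)(x - yN) and dg(X) = (x - yN)dg(1). In df(X)dg(Y) the two
  -- middle factors are polynomials in N and commute.
  have hX : ∀ X : ℂ, X = X.re • 1 + X.im • (Complex.I * 1) := fun X => by
    apply Complex.ext <;> simp
  have e1 : ∀ X, D f p X = X.re • D f p 1 - X.im • (D f p 1 * N p) := fun X => by
    conv_lhs => rw [hX X]
    rw [map_add, map_smul, map_smul, hf.D_I, hf.anticomm, smul_neg, sub_eq_add_neg]
  have e2 : ∀ X, D (parallelSurface f N H) p X = X.re • D (parallelSurface f N H) p 1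
      - X.im • (N p * D (parallelSurface f N H) p 1) := fun X => by
    conv_lhs => rw [hX X]
    rw [map_add, map_smul, map_smul, hf.D_parallel_I hH, smul_neg, sub_eq_add_neg]
  rw [e1 X, e1 Y, e2 X, e2 Y]
  simp only [sub_mul, mul_sub, smul_mul_assoc, mul_smul_comm, mul_assoc]
  module

/-- `dg ∧ df = 0`. -/
theorem D_parallel_wedge (hf : IsCMCImmersion f N H) (hH : H ≠ 0) (p : M) (X Y : ℂ) :
    D (parallelSurface f N H) p X * D f p Y = D (parallelSurface f N H) p Y * D f p X := by
  have h := congrArg star (hf.D_wedge_parallel hH p Y X)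
  simp only [star_mul, star_eq_neg_of_re (hf.re_D p _),
    star_eq_neg_of_re (hf.re_D_parallel p _), neg_mul_neg] at h
  exact h

theorem D_parallel_eq_zero_iff (hf : IsCMCImmersion f N H) (hH : H ≠ 0) (p : M) :
    D (parallelSurface f N H) p = 0 ↔ ∃ X, X ≠ 0 ∧ D (parallelSurface f N H) p X = 0 := by
  refine ⟨fun h => ⟨1, one_ne_zero, by rw [h]; rfl⟩, fun ⟨X, hX, h⟩ => ?_⟩
  ext1 Y
  have := hf.D_wedge_parallel hH p X Y
  rw [h, mul_zero] at this
  exact (mul_eq_zero.1 this).resolve_left (hf.D_ne_zero p hX)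

end IsCMCImmersion

/-! ### The Hopf differential -/

/-- The Cauchy–Riemann equations for Re(FG) - i Re(nFG), with F, G the x-derivatives of f, g and F',
G' their second x-derivatives. The mixed derivatives have been eliminated through f_y = N f_x, g_y =
-N g_x and dN = H dg - H df. -/
theorem hopf_algebra {n F G F' G' : ℍ[ℝ]} (hn : n * n = -1) (hF : n * F = -(F * n))
    (hG : n * G = -(G * n)) :
    (((H • G - H • F) * F + n * F') * G + F * (-((H • G - H • F) * G + n * G'))).re =
        ((H • G - H • F) * (F * G) + n * (F' * G + F * G')).re ∧
      ((F' * G + F * G')).re =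
        -((-(H • (n * G)) - H • (n * F)) * (F * G) + n * (((H • G - H • F) * F + n * F') * G
          + F * (-((H • G - H • F) * G + n * G')))).re := by
  have rF := re_eq_zero_of_anticomm hn hF
  have rG := re_eq_zero_of_anticomm hn hG
  have rnF : (n * F).re = 0 := by
    refine re_eq_zero_of_anticomm hn ?_
    rw [hF, mul_neg, ← mul_assoc, hF]
  have rnG : (n * G).re = 0 := by
    refine re_eq_zero_of_anticomm hn ?_
    rw [hG, mul_neg, ← mul_assoc, hG]
  have hFF := mul_self_eq_coe_of_re rF
  have hGG := mul_self_eq_coe_of_re rG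
  have hFn : F * n = -(n * F) := by rw [hF, neg_neg]
  constructor
  · have e : (((H • G - H • F) * F + n * F') * G + F * (-((H • G - H • F) * G + n * G'))) =
        ((H • G - H • F) * (F * G) + n * (F' * G + F * G')) - H • (F * (G * G)) +
          H • (F * F * G) := by
      have h1 : F * (n * G') = -(n * (F * G')) := by rw [← mul_assoc, hFn, neg_mul, mul_assoc]
      simp only [mul_add, add_mul, sub_mul, mul_sub, mul_neg, mul_assoc, smul_mul_assoc,
        mul_smul_comm, h1]
      module
    rw [e, hGG, hFF, Quaternion.coe_mul_eq_smul, Quaternion.mul_coe_eq_smul]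
    simp [rF, rG]
  · have e : (-(H • (n * G)) - H • (n * F)) * (F * G) + n * (((H • G - H • F) * F + n * F') * G
          + F * (-((H • G - H • F) * G + n * G'))) =
        -(F' * G + F * G') - (2 * H) • (n * (F * F) * G) + H • (n * (F * F) * G)
          - H • (n * F * (G * G)) := by
      have h1 : F * (n * G') = -(n * (F * G')) := by rw [← mul_assoc, hFn, neg_mul, mul_assoc]
      have h2 : ∀ x, n * (n * x) = -x := fun x => by rw [← mul_assoc, hn]; simp
      simp only [mul_add, add_mul, sub_mul, mul_sub, mul_neg, neg_mul, mul_assoc, smul_mul_assoc,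
        mul_smul_comm, h1, h2]
      module
    rw [e, hGG, hFF, Quaternion.mul_coe_eq_smul, Quaternion.mul_coe_eq_smul, smul_mul_assoc]
    simp only [Quaternion.re_add, Quaternion.re_sub, Quaternion.re_neg, Quaternion.re_smul, rnF,
      rnG]
    simp

/-- As F and G anticommute with n, the product FG commutes with n and lies in the span of 1 and n;
the two real parts are its coordinates up to sign. -/
theorem eq_zero_of_hopf {n F G : ℍ[ℝ]} (hn : n * n = -1) (hF : n * F = -(F * n))
    (hG : n * G = -(G * n)) (h1 : (F * G).re = 0) (h2 : (n * (F * G)).re = 0) : F * G = 0 := by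
  have hs := star_eq_neg_of_re h1
  have hs2 := star_eq_neg_of_re h2
  rw [star_mul, hs, star_eq_neg_of_re (re_eq_zero_of_sq hn), neg_mul_neg] at hs2
  have hc : F * G * n = n * (F * G) := by
    rw [mul_assoc, ← neg_eq_iff_eq_neg.2 hG, mul_neg, ← mul_assoc, ← mul_assoc, hF, neg_mul]
  rw [hc] at hs2
  have h3 : n * (F * G) = 0 := by
    have : (2 : ℝ) • (n * (F * G)) = 0 := by
      linear_combination (norm := module) hs2
    exact (smul_eq_zero.1 this).resolve_left two_ne_zero
  have hn0 : n ≠ 0 := by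
    rintro rfl
    simp at hn
  exact (mul_eq_zero.1 h3).resolve_left hn0

theorem nhdsNE_neBot (p : M) : (𝓝[≠] p).NeBot := by
  refine Filter.neBot_iff.2 fun h => ?_
  have h1 : ({p} : Set M) ∈ 𝓝 p := by
    have := Filter.empty_mem_iff_bot.2 h
    rw [mem_nhdsWithin_iff_eventually] at this
    filter_upwards [this] with q hq
    by_contra hne
    exact hq hne
  have hs := mem_chart_source ℂ p
  have h2 := Filter.image_mem_map (m := chartAt ℂ p) h1
  rw [(chartAt ℂ p).map_nhds_eq hs, Set.image_singleton] at h2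
  exact not_isOpen_singleton (chartAt ℂ p p) (isOpen_singleton_iff_nhds_eq_pure _ |>.2
    (le_antisymm (Filter.le_pure_iff.2 h2) (pure_le_nhds _)))

/-- The Hopf differential of `f` in the chart at `p`. -/
def hopf (f N : M → ℍ[ℝ]) (H : ℝ) (p : M) (z : ℂ) : ℂ :=
  ⟨(fderiv ℝ (loc f p) z 1 * fderiv ℝ (loc (parallelSurface f N H) p) z 1).re,
    -(loc N p z * (fderiv ℝ (loc f p) z 1 * fderiv ℝ (loc (parallelSurface f N H) p) z 1)).re⟩

theorem differentiableAt_hopf (hf : IsCMCImmersion f N H) (hH : H ≠ 0) (p : M) {z : ℂ}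
    (hz : z ∈ (chartAt ℂ p).target) : DifferentiableAt ℂ (hopf f N H p) z := by
  set g := parallelSurface f N H with hg
  have hgs : IsSmooth g := hf.smooth_parallel
  have hfI : ∀ z ∈ (chartAt ℂ p).target, fderiv ℝ (loc f p) z Complex.I =
      loc N p z * fderiv ℝ (loc f p) z 1 := by
    intro z hz
    rw [fderiv_loc_eq_D hf.smooth hz, fderiv_loc_eq_D hf.smooth hz, mul_one, mul_comm, hf.D_I]
    rfl
  have hgI : ∀ z ∈ (chartAt ℂ p).target, fderiv ℝ (loc g p) z Complex.I =
      -(loc N p z * fderiv ℝ (loc g p) z 1) := by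
    intro z hz
    rw [fderiv_loc_eq_D hgs hz, fderiv_loc_eq_D hgs hz, mul_one, mul_comm, hf.D_parallel_I hH]
    rfl
  have hN : ∀ X, fderiv ℝ (loc N p) z X =
      H • fderiv ℝ (loc g p) z X - H • fderiv ℝ (loc f p) z X := by
    intro X
    rw [fderiv_loc_eq_D hf.smoothN hz, fderiv_loc_eq_D hgs hz, fderiv_loc_eq_D hf.smooth hz,
      hf.D_normal hH]
  have hn := (differentiableAt_loc hf.smoothN p hz).hasFDerivAt
  have ht : ∀ᶠ z in 𝓝 z, z ∈ (chartAt ℂ p).target := (chartAt ℂ p).open_target.mem_nhds hz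
  have hfI1 : fderiv ℝ (fderiv ℝ (loc f p)) z Complex.I 1 =
      fderiv ℝ (loc N p) z 1 * fderiv ℝ (loc f p) z 1 +
        loc N p z * fderiv ℝ (fderiv ℝ (loc f p)) z 1 1 := by
    rw [fderiv_fderiv_loc_symm hf.smooth p hz]
    have h3 := (hn.mul' (hasFDerivAt_fderiv_loc hf.smooth p hz 1)).congr_of_eventuallyEq
      (f₁ := fun z => fderiv ℝ (loc f p) z Complex.I)
      (ht.mono hfI)
    have h4 := DFunLike.congr_fun ((hasFDerivAt_fderiv_loc hf.smooth p hz Complex.I).unique h3) 1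
    simpa [add_comm] using h4
  have hgI1 : fderiv ℝ (fderiv ℝ (loc g p)) z Complex.I 1 =
      -(fderiv ℝ (loc N p) z 1 * fderiv ℝ (loc g p) z 1 +
        loc N p z * fderiv ℝ (fderiv ℝ (loc g p)) z 1 1) := by
    rw [fderiv_fderiv_loc_symm hgs p hz]
    have h3 := (hn.mul' (hasFDerivAt_fderiv_loc hgs p hz 1)).neg.congr_of_eventuallyEq
      (f₁ := fun z => fderiv ℝ (loc g p) z Complex.I)
      (ht.mono hgI)
    have h4 := DFunLike.congr_fun ((hasFDerivAt_fderiv_loc hgs p hz Complex.I).unique h3) 1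
    simpa [add_comm] using h4
  have hQ := (hasFDerivAt_fderiv_loc hf.smooth p hz 1).mul' (hasFDerivAt_fderiv_loc hgs p hz 1)
  have hnQ := hn.mul' hQ
  have hre : ∀ {a : ℂ → ℍ[ℝ]} {a' : ℂ →L[ℝ] ℍ[ℝ]}, HasFDerivAt a a' z →
      HasFDerivAt (fun z => (a z).re) (((innerSL ℝ (1 : ℍ[ℝ]))).comp a') z := by
    intro a a' ha
    have := ((innerSL ℝ (1 : ℍ[ℝ])).hasFDerivAt (x := a z)).comp z ha
    refine this.congr_of_eventuallyEq (Filter.Eventually.of_forall fun z => ?_)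
    simp [Quaternion.inner_def]
  have hh : HasFDerivAt (hopf f N H p) _ z :=
    (Complex.equivRealProdCLM.symm : ℝ × ℝ →L[ℝ] ℂ).hasFDerivAt.comp z
      ((hre hQ).prodMk (hre hnQ).neg)
  rw [differentiableAt_complex_iff_differentiableAt_real]
  refine ⟨hh.differentiableAt, ?_⟩
  have hq : (chartAt ℂ p).symm z ∈ (chartAt ℂ p).source := (chartAt ℂ p).map_target hz
  have hsq : loc N p z * loc N p z = -1 := hf.sqN _
  have hF : loc N p z * fderiv ℝ (loc f p) z 1 = -(fderiv ℝ (loc f p) z 1 * loc N p z) := by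
    rw [fderiv_loc_eq_D hf.smooth hz]; exact hf.anticomm _ _
  have hG : loc N p z * fderiv ℝ (loc g p) z 1 = -(fderiv ℝ (loc g p) z 1 * loc N p z) := by
    rw [fderiv_loc_eq_D hgs hz]; exact hf.anticomm_parallel _ _
  have key := hopf_algebra (H := H) (F' := fderiv ℝ (fderiv ℝ (loc f p)) z 1 1)
    (G' := fderiv ℝ (fderiv ℝ (loc g p)) z 1 1) hsq hF hG
  have hval : ∀ X, fderiv ℝ (hopf f N H p) z X =
      ⟨(fderiv ℝ (fderiv ℝ (loc f p)) z X 1 * fderiv ℝ (loc g p) z 1 +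
          fderiv ℝ (loc f p) z 1 * fderiv ℝ (fderiv ℝ (loc g p)) z X 1).re,
        -(fderiv ℝ (loc N p) z X * (fderiv ℝ (loc f p) z 1 * fderiv ℝ (loc g p) z 1) +
          loc N p z * (fderiv ℝ (fderiv ℝ (loc f p)) z X 1 * fderiv ℝ (loc g p) z 1 +
          fderiv ℝ (loc f p) z 1 * fderiv ℝ (fderiv ℝ (loc g p)) z X 1)).re⟩ := by
    intro X
    rw [hh.fderiv]
    apply Complex.ext <;> simp [Quaternion.inner_def] <;> ring
  rw [hval, hval, hfI1, hgI1, hN, hN, hfI z hz, hgI z hz]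
  have k1 := key.1
  have k2 := key.2
  apply Complex.ext
  · simp only [smul_eq_mul, Complex.mul_re, Complex.I_re, Complex.I_im, zero_mul, one_mul, zero_sub,
      neg_neg]
    rw [← k1]
  · simp only [smul_eq_mul, Complex.mul_im, Complex.I_re, Complex.I_im, zero_mul, one_mul, zero_add]
    rw [k2, smul_neg]

theorem hopf_eq_zero_iff (hf : IsCMCImmersion f N H) (hH : H ≠ 0) (p : M) {z : ℂ}
    (hz : z ∈ (chartAt ℂ p).target) :
    hopf f N H p z = 0 ↔ D (parallelSurface f N H) ((chartAt ℂ p).symm z) = 0 := by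
  have hq := (chartAt ℂ p).map_target hz
  have hc := inv_ne_zero (transDeriv_ne_zero hq)
  rw [hf.D_parallel_eq_zero_iff hH, hopf, fderiv_loc_eq_D hf.smooth hz,
    fderiv_loc_eq_D hf.smooth_parallel hz, mul_one]
  set q := (chartAt ℂ p).symm z
  set c := (transDeriv p q)⁻¹
  constructor
  · intro h
    have h1 := congrArg Complex.re h
    have h2 := congrArg Complex.im h
    have h3 := eq_zero_of_hopf (hf.sqN q) (hf.anticomm q c) (hf.anticomm_parallel q c) h1
      (neg_eq_zero.1 h2)
    exact ⟨c, hc, (mul_eq_zero.1 h3).resolve_left (hf.D_ne_zero q hc)⟩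
  · intro h
    rw [(hf.D_parallel_eq_zero_iff hH q).2 h]
    apply Complex.ext <;> simp

/-- This is the identity theorem for the Hopf differential, whose zeros are exactly those of dg. -/
theorem eventually_D_parallel (hf : IsCMCImmersion f N H) (hH : H ≠ 0) (p : M) :
    (∀ᶠ q in 𝓝 p, D (parallelSurface f N H) q = 0) ∨
      ∀ᶠ q in 𝓝[≠] p, D (parallelSurface f N H) q ≠ 0 := by
  have hs := mem_chart_source ℂ p
  have ht := (chartAt ℂ p).open_target.mem_nhds (mem_chart_target ℂ p)
  have han : AnalyticAt ℂ (hopf f N H p) (chartAt ℂ p p) :=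
    DifferentiableOn.analyticAt
      (fun z hz => (differentiableAt_hopf hf hH p hz).differentiableWithinAt)
      ht
  have hc := (chartAt ℂ p).continuousAt hs
  have hsrc := (chartAt ℂ p).open_source.mem_nhds hs
  rcases han.eventually_eq_zero_or_eventually_ne_zero with h | h
  · left
    filter_upwards [hc.eventually h, hsrc] with q hq hqs
    rw [hopf_eq_zero_iff hf hH p ((chartAt ℂ p).map_source hqs), (chartAt ℂ p).left_inv hqs] at hq
    exact hq
  · right
    rw [eventually_nhdsWithin_iff] at h ⊢
    filter_upwards [hc.eventually h, hsrc] with q hq hqs hne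
    have h1 := hq fun he => hne ((chartAt ℂ p).injOn hqs hs he)
    rw [Ne, hopf_eq_zero_iff hf hH p ((chartAt ℂ p).map_source hqs),
      (chartAt ℂ p).left_inv hqs] at h1
    exact h1

/-- Away from round spheres, the parallel surface of a constant mean curvature surface has isolated
branch points. -/
theorem isolated_parallel [PreconnectedSpace M] (hf : IsCMCImmersion f N H) (hH : H ≠ 0)
    (hround : ¬ ∃ (c : ℍ[ℝ]) (ρ : ℝ), c.re = 0 ∧ Set.range f ⊆ Metric.sphere c ρ) (p : M) :
    ∀ᶠ q in 𝓝[≠] p, D (parallelSurface f N H) q ≠ 0 := by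
  set g := parallelSurface f N H with hg
  let S : Set M := {p | ∀ᶠ q in 𝓝 p, D g q = 0}
  have hSo : IsOpen S := isOpen_setOfPred_eventually_nhds
  have hSc : IsClosed S := by
    refine isClosed_of_closure_subset fun x hx => ?_
    rcases eventually_D_parallel hf hH x with h | h
    · exact h
    · rw [eventually_nhdsWithin_iff] at h
      obtain ⟨y, hy1, hy2⟩ := mem_closure_iff_nhds.1 hx _ h
      have hy3 : D g y = 0 := (show ∀ᶠ q in 𝓝 y, D g q = 0 from hy2).self_of_nhds
      by_cases hyx : y = x
      · rwa [hyx] at hy2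
      · exact absurd hy3 (hy1 hyx)
  -- If dg vanishes on an open set it vanishes everywhere, so g is constant and f = g - N/H lies on
  -- the sphere of radius 1/|H| about g.
  rcases isClopen_iff.1 ⟨hSc, hSo⟩ with h | h
  · refine (eventually_D_parallel hf hH p).resolve_left fun hp => ?_
    have : p ∈ S := hp
    rw [h] at this
    exact this
  · exfalso
    have h0 : ∀ q, D g q = 0 := fun q => by
      have : q ∈ S := by rw [h]; exact Set.mem_univ q
      exact (show ∀ᶠ r in 𝓝 q, D g r = 0 from this).self_of_nhds
    apply hround
    refine ⟨g p, ‖H⁻¹‖, ?_, ?_⟩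
    · simp [hg, parallelSurface, hf.im, hf.reN]
    · rintro _ ⟨q, rfl⟩
      have h1 := eq_of_D_eq_zero hf.smooth_parallel h0 p q
      have h2 : ‖N q‖ = 1 := by
        have h3 := congrArg norm (hf.sqN q)
        rw [norm_mul, norm_neg, norm_one] at h3
        nlinarith [norm_nonneg (N q)]
      rw [mem_sphere_iff_norm, hg, h1, parallelSurface, sub_add_cancel_left, norm_neg, norm_smul,
        h2, mul_one]

end Surface

/-! ### Quaternionic lines and the sphere touching two surfaces. -/

section Lines

theorem mem_affine_iff {x : ℍ[ℝ]} {v : H2} : v ∈ (affine x).submodule ↔ v.1 = x * v.2 := by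
  rw [affine, Projectivization.submodule_mk, Submodule.mem_span_singleton]
  constructor
  · rintro ⟨a, rfl⟩
    simp [MulOpposite.smul_eq_mul_unop]
  · intro h
    refine ⟨MulOpposite.op v.2, ?_⟩
    apply Prod.ext
    · simp [MulOpposite.smul_eq_mul_unop, h]
    · simp [MulOpposite.smul_eq_mul_unop]

theorem affine_eq_mk_iff {x : ℍ[ℝ]} {v : H2} (hv : v ≠ 0) :
    affine x = Projectivization.mk (ℍ[ℝ])ᵐᵒᵖ v hv ↔ v.1 = x * v.2 := by
  rw [← mem_affine_iff]
  constructor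
  · intro h
    rw [h, Projectivization.submodule_mk]
    exact Submodule.mem_span_singleton_self v
  · intro h
    rw [affine, Projectivization.submodule_mk, Submodule.mem_span_singleton] at h
    obtain ⟨a, ha⟩ := h
    rw [affine]
    exact ((Projectivization.mk_eq_mk_iff' _ _ _ hv _).2 ⟨a, ha⟩).symm

/-- The complex structure on `ℍ²` whose 2-sphere touches two surfaces through `a` and `b`, with
normals `n` and `m`; here `w = (b - a)⁻¹`. -/
def touchingSphere (a b n m w : ℍ[ℝ]) : H2 →ₗ[(ℍ[ℝ])ᵐᵒᵖ] H2 where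
  toFun v := ((a * n - b * m) * w * (v.1 - a * v.2) - a * n * v.2,
    (n - m) * w * (v.1 - a * v.2) - n * v.2)
  map_add' v v' := by
    apply Prod.ext <;> simp only [Prod.fst_add, Prod.snd_add] <;> noncomm_ring
  map_smul' c v := by
    apply Prod.ext <;>
      simp only [Prod.smul_fst, Prod.smul_snd, MulOpposite.smul_eq_mul_unop, RingHom.id_apply] <;>
      noncomm_ring

theorem touchingSphere_apply (a b n m w : ℍ[ℝ]) (v : H2) :
    touchingSphere a b n m w v = ((a * n - b * m) * w * (v.1 - a * v.2) - a * n * v.2,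
      (n - m) * w * (v.1 - a * v.2) - n * v.2) := rfl

theorem touchingSphere_left (a b n m w x : ℍ[ℝ]) :
    touchingSphere a b n m w (a * x, x) = -(a * (n * x), n * x) := by
  rw [touchingSphere_apply]
  apply Prod.ext <;> simp [mul_assoc]

theorem touchingSphere_right {a b n m w : ℍ[ℝ]} (hw : w * (b - a) = 1) (x : ℍ[ℝ]) :
    touchingSphere a b n m w (b * x, x) = -(b * (m * x), m * x) := by
  have h : ∀ y, y * w * (b * x - a * x) = y * x := fun y => by
    rw [← sub_mul, mul_assoc, ← mul_assoc w, hw, one_mul]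
  rw [touchingSphere_apply]
  apply Prod.ext
  · simp only [h, Prod.fst_neg]; noncomm_ring
  · simp only [h, Prod.snd_neg]; noncomm_ring

theorem touchingSphere_sq {a b n m w : ℍ[ℝ]} (hw : w * (b - a) = 1) (hw' : (b - a) * w = 1)
    (hn : n * n = -1) (hm : m * m = -1) (v : H2) :
    touchingSphere a b n m w (touchingSphere a b n m w v) = -v := by
  obtain ⟨x, y, rfl⟩ : ∃ x y : ℍ[ℝ], v = (a * x, x) + (b * y, y) := by
    refine ⟨v.2 - w * (v.1 - a * v.2), w * (v.1 - a * v.2), Prod.ext ?_ (by simp)⟩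
    have : (b - a) * (w * (v.1 - a * v.2)) = v.1 - a * v.2 := by rw [← mul_assoc, hw', one_mul]
    simp only [Prod.fst_add]
    rw [sub_mul] at this
    rw [mul_sub, sub_add_eq_add_sub, add_sub_assoc, this]
    abel
  rw [map_add, touchingSphere_left, touchingSphere_right hw, map_add, map_neg, map_neg,
    touchingSphere_left, touchingSphere_right hw, ← mul_assoc n, ← mul_assoc m, hn, hm]
  apply Prod.ext <;> simp [add_comm]

end Lines

/-! ### A criterion for enveloping. -/

section Envelopes

variable {M : Type*} [TopologicalSpace M] [ChartedSpace ℂ M] [IsManifold 𝓘(ℂ, ℂ) ω M]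

theorem D_fst {σ : M → H2} (hσ : IsSmooth σ) (p : M) (X : ℂ) :
    (D σ p X).1 = D (fun p => (σ p).1) p X :=
  (D_clm (ContinuousLinearMap.fst ℝ ℍ[ℝ] ℍ[ℝ]) hσ p X).symm

theorem D_snd {σ : M → H2} (hσ : IsSmooth σ) (p : M) (X : ℂ) :
    (D σ p X).2 = D (fun p => (σ p).2) p X :=
  (D_clm (ContinuousLinearMap.snd ℝ ℍ[ℝ] ℍ[ℝ]) hσ p X).symm

theorem IsSmooth.fst {σ : M → H2} (hσ : IsSmooth σ) : IsSmooth (fun p => (σ p).1) :=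
  hσ.comp_contDiff contDiff_fst

theorem IsSmooth.snd {σ : M → H2} (hσ : IsSmooth σ) : IsSmooth (fun p => (σ p).2) :=
  hσ.comp_contDiff contDiff_snd

/-- It suffices that S acts as -n on the line and, by `hS'`, as n on the quotient, identified with
the first coordinate axis: then Sδ and δS become n dh and -dh n, both equal to *dh. -/
theorem envelopes_of {S : M → (H2 →ₗ[(ℍ[ℝ])ᵐᵒᵖ] H2)} {h n : M → ℍ[ℝ]} (hh : IsSmooth h)
    (hn : IsSmooth n) (hnn : ∀ p, n p * n p = -1)
    (hleft : ∀ p X, starD h p X = n p * D h p X) (hright : ∀ p X, starD h p X = -(D h p X * n p))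
    (hS : ∀ p x, S p (h p * x, x) = -(h p * (n p * x), n p * x))
    (hS' : ∀ p u, (S p (u, 0)).1 - n p * u = h p * (S p (u, 0)).2) :
    Envelopes S (fun p => affine (h p)) := by
  have key : ∀ σ, IsSection (fun p => affine (h p)) σ → (∀ p, σ p = (h p * (σ p).2, (σ p).2)) ∧
      ∀ p X, D σ p X = (h p * D (fun p => (σ p).2) p X, D (fun p => (σ p).2) p X) +
        (D h p X * (σ p).2, 0) := by
    rintro σ ⟨hσ, hm⟩
    have h1 : ∀ p, σ p = (h p * (σ p).2, (σ p).2) := fun p =>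
      Prod.ext (mem_affine_iff.1 (hm p)) rfl
    refine ⟨h1, fun p X => Prod.ext ?_ ?_⟩
    · rw [D_fst hσ]
      have h2 : (fun p => (σ p).1) = fun p => h p * (σ p).2 := funext fun p => by
        conv_lhs => rw [h1 p]
      rw [h2, D_mul hh hσ.snd]; rfl
    · rw [D_snd hσ]; simp
  refine ⟨fun p => ?_, fun σ hσ p X => ?_, fun σ hσ p X => ?_⟩
  · apply le_antisymm
    · rintro _ ⟨v, hv, rfl⟩
      have hv' : v = (h p * v.2, v.2) := Prod.ext (mem_affine_iff.1 hv) rfl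
      rw [hv', hS, mem_affine_iff]
      simp
    · intro v hv
      have hv' : v = (h p * v.2, v.2) := Prod.ext (mem_affine_iff.1 hv) rfl
      refine ⟨(h p * (n p * v.2), n p * v.2), mem_affine_iff.2 rfl, ?_⟩
      rw [hS, ← mul_assoc (n p), hnn, hv']
      apply Prod.ext <;> simp
  · obtain ⟨-, h2⟩ := key σ hσ
    rw [starD, h2, h2, map_add, hS, mem_affine_iff]
    have h3 := hS' p (D h p X * (σ p).2)
    have h4 : D h p (Complex.I * X) = n p * D h p X := hleft p X
    rw [sub_eq_iff_eq_add] at h3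
    simp only [Prod.fst_sub, Prod.snd_sub, Prod.fst_add, Prod.snd_add, Prod.fst_neg, Prod.snd_neg]
    rw [h3, h4]
    noncomm_ring
  · obtain ⟨h1, h2⟩ := key σ hσ
    have h5 : (fun q => S q (σ q)) = fun q => (-(h q * (n q * (σ q).2)), -(n q * (σ q).2)) :=
      funext fun q => by
        conv_lhs => rw [h1 q, hS]
        rfl
    have hs := hσ.1.snd
    have h6 : IsSmooth (fun q => S q (σ q)) := by
      rw [h5]; exact (hh.mul (hn.mul hs)).neg.prodMk (hn.mul hs).neg
    have h3 := hS' p (D h p X * (σ p).2)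
    have h4 : n p * D h p X = -(D h p X * n p) := (hleft p X).symm.trans (hright p X)
    rw [sub_eq_iff_eq_add, ← mul_assoc, h4] at h3
    rw [h2, map_add, hS, mem_affine_iff]
    simp only [Prod.fst_sub, Prod.snd_sub, Prod.fst_add, Prod.snd_add, Prod.fst_neg, Prod.snd_neg]
    rw [D_fst h6, D_snd h6, h3]
    have e1 : (fun q => (S q (σ q)).1) = fun q => -(h q * (n q * (σ q).2)) :=
      funext fun q => by rw [congrFun h5 q]
    have e2 : (fun q => (S q (σ q)).2) = fun q => -(n q * (σ q).2) :=
      funext fun q => by rw [congrFun h5 q]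
    rw [e1, e2, D_neg (hh.mul (hn.mul hs)), D_mul hh (hn.mul hs), D_neg (hn.mul hs)]
    noncomm_ring

end Envelopes

/-! ### From the Riccati equation to a classical Darboux transform of mean curvature H. -/

section Core

variable {M : Type*} [TopologicalSpace M] [ChartedSpace ℂ M] [IsManifold 𝓘(ℂ, ℂ) ω M]
variable {f N : M → ℍ[ℝ]} {H : ℝ}

/-- The data of a Darboux transform `f + w⁻¹` of a constant mean curvature surface: `w` is an
imaginary solution of the Riccati equation `dw = w df w + ρ dg` with the right value of the first
integral. -/
structure IsRiccati (f N : M → ℍ[ℝ]) (H : ℝ) (ρ : ℝ) (w : M → ℍ[ℝ]) : Prop where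
  smooth : IsSmooth w
  re : ∀ p, (w p).re = 0
  ne_zero : ∀ p, w p ≠ 0
  rho : ρ ≠ 0
  deriv : ∀ p X, D w p X = w p * D f p X * w p + ρ • D (parallelSurface f N H) p X
  integral : ∀ p, w p * w p + ρ • 1 = (ρ / H) • (w p * N p + N p * w p)

theorem sq_mul_comm {w : ℍ[ℝ]} (h : w.re = 0) (x : ℍ[ℝ]) : w * (w * x) = x * (w * w) := by
  rw [← mul_assoc, mul_self_eq_coe_of_re h]
  exact Quaternion.coe_commutes _ _

/-- The square of an imaginary quaternion is real, so conjugation by w and by w⁻¹ agree. This makes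
the left and right normals of the transform coincide. -/
theorem conj_inv_comm {w : ℍ[ℝ]} (h : w.re = 0) (h0 : w ≠ 0) (x : ℍ[ℝ]) :
    w⁻¹ * x * w = w * x * w⁻¹ := by
  have h1 := sq_mul_comm h x
  calc w⁻¹ * x * w = w⁻¹ * (x * (w * w)) * w⁻¹ := by
        rw [mul_assoc w⁻¹, mul_assoc w⁻¹, mul_assoc x, mul_assoc w, mul_inv_cancel₀ h0, mul_one]
    _ = w * x * w⁻¹ := by rw [← h1, inv_mul_cancel_left₀ h0]

theorem D_inv {w : M → ℍ[ℝ]} (hw : IsSmooth w) (h0 : ∀ p, w p ≠ 0) (p : M) (X : ℂ) :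
    D (fun p => (w p)⁻¹) p X = -((w p)⁻¹ * D w p X * (w p)⁻¹) := by
  have h1 := D_mul (hw.inv h0) hw p X
  have h2 : (fun p => (w p)⁻¹ * w p) = fun _ => (1 : ℍ[ℝ]) :=
    funext fun p => inv_mul_cancel₀ (h0 p)
  rw [h2, D_const] at h1
  have h3 : D (fun p => (w p)⁻¹) p X * w p = -((w p)⁻¹ * D w p X) :=
    eq_neg_of_add_eq_zero_right h1.symm
  rw [← mul_inv_cancel_right₀ (h0 p) (D (fun p => (w p)⁻¹) p X), h3, neg_mul]

namespace IsRiccati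

variable {ρ : ℝ} {w : M → ℍ[ℝ]}

/-- The Riccati term w df w cancels df, so the transform inherits conformality and branch points
from g alone. -/
theorem D_transform (hf : IsCMCImmersion f N H) (hw : IsRiccati f N H ρ w) (p : M) (X : ℂ) :
    D (fun p => f p + (w p)⁻¹) p X =
      -(ρ • ((w p)⁻¹ * D (parallelSurface f N H) p X * (w p)⁻¹)) := by
  have h0 := hw.ne_zero p
  rw [D_add hf.smooth (hw.smooth.inv hw.ne_zero), D_inv hw.smooth hw.ne_zero, hw.deriv]
  simp only [mul_add, add_mul, mul_assoc, mul_inv_cancel₀ h0, inv_mul_cancel_left₀ h0, mul_one,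
    smul_mul_assoc, mul_smul_comm]
  abel

/-- The first integral multiplied by H/ρ and by w⁻¹ from the left. It removes conjugation from the
normal, which can then be differentiated term by term. -/
theorem normal_eq (hH : H ≠ 0) (hw : IsRiccati f N H ρ w) (p : M) :
    -((w p)⁻¹ * N p * w p) = N p - (H / ρ) • w p - H • (w p)⁻¹ := by
  have h0 := hw.ne_zero p
  have hρ := hw.rho
  have h1 := congrArg (fun x => (H / ρ) • ((w p)⁻¹ * x)) (hw.integral p)
  simp only [mul_add, inv_mul_cancel_left₀ h0, mul_smul_comm, mul_one, smul_add, smul_smul,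
    ← mul_assoc] at h1
  rw [div_mul_cancel₀ _ hρ, show H / ρ * (ρ / H) = 1 by field_simp] at h1
  simp only [one_smul] at h1
  linear_combination (norm := module) h1

theorem isGaussMap (hf : IsCMCImmersion f N H) (hH : H ≠ 0) (hw : IsRiccati f N H ρ w) :
    IsGaussMap (fun p => f p + (w p)⁻¹) (fun p => -((w p)⁻¹ * N p * w p)) where
  smooth := (((hw.smooth.inv hw.ne_zero).mul hf.smoothN).mul hw.smooth).neg
  sq p := by
    have h0 := hw.ne_zero p
    rw [neg_mul_neg]
    simp only [mul_assoc, mul_inv_cancel_left₀ h0]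
    rw [← mul_assoc (N p) (N p), hf.sqN]
    simp [inv_mul_cancel₀ h0]
  left p X := by
    have h0 := hw.ne_zero p
    rw [starD, hw.D_transform hf, hw.D_transform hf, hf.D_parallel_I hH]
    simp only [mul_assoc, mul_neg, neg_mul, mul_smul_comm, mul_inv_cancel_left₀ h0]
  right p X := by
    have h0 := hw.ne_zero p
    rw [starD, hw.D_transform hf, hw.D_transform hf, hf.D_parallel_I hH, hf.anticomm_parallel,
      conj_inv_comm (hw.re p) h0]
    simp only [mul_assoc, mul_neg, neg_mul, smul_mul_assoc, neg_neg, inv_mul_cancel_left₀ h0]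

theorem hasMeanCurvature (hf : IsCMCImmersion f N H) (hH : H ≠ 0) (hw : IsRiccati f N H ρ w) :
    HasMeanCurvature (fun p => f p + (w p)⁻¹) (fun p => -((w p)⁻¹ * N p * w p)) H := by
  have hG := hw.isGaussMap hf hH
  refine ⟨hG, fun p X => ?_⟩
  have h0 := hw.ne_zero p
  have hρ := hw.rho
  have hD : ∀ X, D (fun p => -((w p)⁻¹ * N p * w p)) p X =
      -((H / ρ) • (w p * D f p X * w p)) - H • D (fun p => f p + (w p)⁻¹) p X := by
    intro X
    have e : (fun p => -((w p)⁻¹ * N p * w p)) =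
        fun p => N p - (H / ρ) • w p - H • (w p)⁻¹ := funext (hw.normal_eq hH)
    rw [e, D_sub (hf.smoothN.sub (hw.smooth.const_smul _))
        ((hw.smooth.inv hw.ne_zero).const_smul _),
      D_sub hf.smoothN (hw.smooth.const_smul _), D_const_smul _ hw.smooth,
      D_const_smul _ (hw.smooth.inv hw.ne_zero), hw.deriv, hf.D_normal hH,
      D_add hf.smooth (hw.smooth.inv hw.ne_zero), smul_add, smul_smul, div_mul_cancel₀ _ hρ]
    module
  have hl := hG.left p X
  rw [starD] at hl
  rw [dNormalPrime, starD, hD, hD, hl, hf.D_I]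
  have hNN : ∀ x, N p * (N p * x) = -x := fun x => by rw [← mul_assoc, hf.sqN]; simp
  -- The form w df w has no (1,0)-part for the new normal, because w² is real and N² = -1; only -H
  -- df♯ survives in (dN♯)'.
  have h1 : (w p)⁻¹ * N p * w p * (w p * (N p * D f p X) * w p) = -(w p * D f p X * w p) := by
    have h2 : N p * (w p * (w p * (N p * (D f p X * w p)))) =
        w p * (w p * (N p * (N p * (D f p X * w p)))) := by
      have := sq_mul_comm (hw.re p) (N p)
      rw [← mul_assoc (w p) (w p) (N p * (N p * _)), ← mul_assoc (w p * w p) (N p),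
        mul_assoc (w p) (w p) (N p), this]
      simp only [mul_assoc]
    simp only [mul_assoc]
    rw [h2, inv_mul_cancel_left₀ h0, hNN, mul_neg]
  have h3 : ∀ x, (w p)⁻¹ * N p * w p * ((w p)⁻¹ * N p * w p * x) = -x := fun x => by
    simp only [mul_assoc, mul_inv_cancel_left₀ h0, hNN, mul_neg, inv_mul_cancel_left₀ h0]
  simp only [neg_mul, mul_sub, mul_neg, mul_smul_comm, h1, h3]
  module

theorem isClassicalDarboux (hf : IsCMCImmersion f N H) (hH : H ≠ 0) (hw : IsRiccati f N H ρ w)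
    (hiso : ∀ p, ∀ᶠ q in 𝓝[≠] p, D (parallelSurface f N H) q ≠ 0) :
    IsClassicalDarboux f (fun p => f p + (w p)⁻¹) := by
  have hG := hw.isGaussMap hf hH
  have hs : IsSmooth (fun p => f p + (w p)⁻¹) := hf.smooth.add (hw.smooth.inv hw.ne_zero)
  refine ⟨⟨hs, ⟨_, _, hG.smooth, hG.smooth, hG.sq, hG.sq, hG.left, hG.right⟩, fun p => ?_⟩,
    fun p h => ?_,
    fun p => touchingSphere (f p) (f p + (w p)⁻¹) (N p) (-((w p)⁻¹ * N p * w p)) (w p),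
    ⟨fun v => ?_, fun p v => ?_⟩, ?_, ?_⟩
  · filter_upwards [hiso p] with q hq h
    apply hq
    ext1 X
    have h1 := hw.D_transform hf q X
    rw [h] at h1
    have h2 := neg_eq_zero.1 h1.symm
    simpa [hw.rho, hw.ne_zero q] using h2
  · exact inv_ne_zero (hw.ne_zero p) (left_eq_add.1 h)
  · have c1 := isSmooth_const (M := M) v.1
    have c2 := isSmooth_const (M := M) v.2
    have d := c1.sub (hf.smooth.mul c2)
    exact ((((hf.smooth.mul hf.smoothN).sub (hs.mul hG.smooth)).mul hw.smooth).mul d |>.sub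
      ((hf.smooth.mul hf.smoothN).mul c2)).prodMk
      ((((hf.smoothN.sub hG.smooth).mul hw.smooth).mul d).sub (hf.smoothN.mul c2))
  · have h0 := hw.ne_zero p
    exact touchingSphere_sq (by simp [h0]) (by simp [h0]) (hf.sqN p) (hG.sq p) v
  · refine envelopes_of hf.smooth hf.smoothN hf.sqN hf.mean.1.left hf.mean.1.right
      (fun p x => touchingSphere_left _ _ _ _ _ _) (fun p u => ?_)
    have h0 := hw.ne_zero p
    rw [touchingSphere_apply]
    simp only [mul_zero, sub_zero]
    -- On the quotient by the line of f the touching sphere acts by -w⁻¹N♯w. This equals N exactly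
    -- because conjugation by w is an involution.
    have h1 : (w p)⁻¹ * ((w p)⁻¹ * N p * w p) * w p = N p := by
      rw [conj_inv_comm (hw.re p) h0]
      simp only [mul_assoc, mul_inv_cancel_left₀ h0, mul_inv_cancel₀ h0, mul_one]
    linear_combination (norm := noncomm_ring) h1 * u
  · refine envelopes_of hs hG.smooth hG.sq hG.left hG.right
      (fun p x => touchingSphere_right (by simp [hw.ne_zero p]) x) (fun p u => ?_)
    rw [touchingSphere_apply]
    simp only [mul_zero, sub_zero]
    noncomm_ring

end IsRiccati

end Core

/-! ### Algebra of the spectral parameter. -/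

section Spectral

/-- The quaternion `i`, the image of the imaginary unit. -/
def quatI : ℍ[ℝ] := ((Complex.I : ℂ) : ℍ[ℝ])

theorem quatI_mul_self : quatI * quatI = -1 := by
  rw [quatI, ← Quaternion.coeComplex_mul, Complex.I_mul_I]
  apply Quaternion.ext <;> simp

/-- The candidates for μ are the roots a + 1 ± √(a² + 2a) of μ + μ⁻¹ = 2(a + 1), mutually inverse
and real by `h`. -/
theorem exists_spectral_parameter {a : ℝ} (ha : a ≠ 0) (h : 0 ≤ a ^ 2 + 2 * a) :
    ∃ μ : ℝ, μ ≠ 0 ∧ μ ≠ 1 ∧ (μ + μ⁻¹ - 2) / 2 = a ∧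
      ((μ⁻¹ - μ) / 2) ^ 2 = a ^ 2 + 2 * a := by
  have hs := Real.sq_sqrt h
  set s := √(a ^ 2 + 2 * a)
  have hp : (a + 1 - s) * (a + 1 + s) = 1 := by nlinarith
  have hinv : (a + 1 - s)⁻¹ = a + 1 + s := inv_eq_of_mul_eq_one_right hp
  have e1 : ((a + 1 - s) + (a + 1 - s)⁻¹ - 2) / 2 = a := by rw [hinv]; ring
  refine ⟨a + 1 - s, left_ne_zero_of_mul_eq_one hp, fun h1 => ha ?_, e1, ?_⟩
  · rw [h1] at e1
    norm_num at e1
    exact e1.symm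
  · rw [hinv, ← hs]; ring

theorem spectral_sq {μ : ℝ} (h0 : μ ≠ 0) :
    ((μ⁻¹ - μ) / 2) ^ 2 = ((μ + μ⁻¹ - 2) / 2) ^ 2 + 2 * ((μ + μ⁻¹ - 2) / 2) := by
  field_simp
  ring

theorem spectral_ne_zero {μ : ℝ} (h0 : μ ≠ 0) (h1 : μ ≠ 1) : (μ + μ⁻¹ - 2) / 2 ≠ 0 := by
  intro h
  have h2 : (μ - 1) ^ 2 = 0 := by
    field_simp at h
    nlinarith
  exact h1 (sub_eq_zero.1 (pow_eq_zero_iff two_ne_zero |>.1 h2))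

/-- The quaternion `j`. -/
def quatJ : ℍ[ℝ] := ⟨0, 0, 1, 0⟩

/-- An imaginary `m` with `m² = -b²` is `b` times a conjugate of `i`. -/
theorem exists_conj_quatI {m : ℍ[ℝ]} {b : ℝ} (hm : m * m = -(b ^ 2 • 1)) :
    ∃ c : ℍ[ℝ], c ≠ 0 ∧ m * c = b • (c * quatI) := by
  by_cases hb : b = 0
  · subst hb
    have : m = 0 := by simpa using hm
    exact ⟨1, one_ne_zero, by simp [this]⟩
  -- Since m² = -b², the operator q ↦ mq + bqi maps every q to an eigenvector, possibly zero. It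
  -- kills 1 only for m = -bi, and then it does not kill j.
  have key : ∀ q : ℍ[ℝ], m * (m * q + b • (q * quatI)) =
      b • ((m * q + b • (q * quatI)) * quatI) := by
    intro q
    have h1 : m * (m * q) = -(b ^ 2 • q) := by rw [← mul_assoc, hm]; simp
    simp only [mul_add, add_mul, mul_smul_comm, smul_mul_assoc, mul_assoc, quatI_mul_self, h1]
    simp only [mul_neg, mul_one]
    module
  by_cases h1 : m * 1 + b • (1 * quatI) = 0
  · refine ⟨_, fun h2 => ?_, key quatJ⟩
    have hm' : m = -(b • quatI) := by
      rw [mul_one, one_mul] at h1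
      exact eq_neg_of_add_eq_zero_left h1
    rw [hm'] at h2
    have h3 := congrArg QuaternionAlgebra.imK h2
    have e1 : quatJ.re = 0 := rfl
    have e2 : quatJ.imI = 0 := rfl
    have e3 : quatJ.imJ = 1 := rfl
    have e4 : quatJ.imK = 0 := rfl
    simp [quatI, e1, e2, e3, e4] at h3
    apply hb
    linarith
  · exact ⟨_, h1, key 1⟩

end Spectral

/-! ### Parallel sections and solutions of the Riccati equation. -/

section SpectralFamily

variable {M : Type*} [TopologicalSpace M] [ChartedSpace ℂ M] [IsManifold 𝓘(ℂ, ℂ) ω M]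
variable {f N : M → ℍ[ℝ]} {H : ℝ}

theorem nablaMu_eq (hf : IsCMCImmersion f N H) (μ : ℝ) (α : M → ℍ[ℝ]) (p : M) (X : ℂ) :
    nablaMu N (μ : ℂ) α p X = D α p X + D f p X * ((H / 2) •
      (((μ + μ⁻¹ - 2) / 2) • (N p * α p) + ((μ⁻¹ - μ) / 2) • (α p * quatI))) := by
  have e1 : (((((μ : ℂ) + (μ : ℂ)⁻¹ - 2) / 2 : ℂ)) : ℍ[ℝ]) = (((μ + μ⁻¹ - 2) / 2 : ℝ) : ℍ[ℝ]) := by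
    rw [← Quaternion.coeComplex_coe]
    push_cast
    rfl
  have e2 : (((((μ : ℂ)⁻¹ - (μ : ℂ)) / 2 * Complex.I : ℂ)) : ℍ[ℝ]) =
      ((μ⁻¹ - μ) / 2 : ℝ) • quatI := by
    rw [← Quaternion.coe_mul_eq_smul, ← Quaternion.coeComplex_coe, quatI,
      ← Quaternion.coeComplex_mul]
    push_cast
    rfl
  rw [nablaMu, starA, hf.mean.2, e1, e2, Quaternion.mul_coe_eq_smul]
  simp only [mul_smul_comm, mul_add, smul_add, smul_mul_assoc, smul_neg, neg_neg]
  module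

/-- The first integral turns the commutator of m = (2/H)w - aN with df w into dm. Both directions
use it: once to derive the Riccati equation, once to see that m is parallel. -/
theorem riccati_algebra {a ρ : ℝ} (hH : H ≠ 0) (hρ : ρ = a * H ^ 2 / 2) {n w F : ℍ[ℝ]}
    (hF : n * F = -(F * n)) (hint : w * w + ρ • 1 = (ρ / H) • (w * n + n * w)) :
    ((2 / H) • w - a • n) * (F * w) - F * w * ((2 / H) • w - a • n) =
      (2 / H) • (w * F * w) + (a * H) • F := by
  have h1 : (2 / H) • (F * (w * w + ρ • 1)) = (2 / H) • (F * ((ρ / H) • (w * n + n * w))) := by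
    rw [hint]
  have h2 : n * (F * w) = -(F * (n * w)) := by rw [← mul_assoc, hF, neg_mul, mul_assoc]
  have h3 : (2 / H) * (ρ / H) = a := by rw [hρ]; field_simp
  have h4 : (2 / H) * ρ = a * H := by rw [hρ]; field_simp
  simp only [mul_add, mul_smul_comm, mul_one, smul_add, smul_smul, h3, h4] at h1
  simp only [sub_mul, mul_sub, smul_mul_assoc, mul_smul_comm, h2, mul_assoc]
  linear_combination (norm := module) -h1

theorem riccati_of_parallel (hf : IsCMCImmersion f N H) (hH : H ≠ 0) {μ : ℝ} (h0 : μ ≠ 0)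
    (h1 : μ ≠ 1) {F : M → HP1} (hF : IsMuDarboux f N (μ : ℂ) F) :
    ∃ (ρ : ℝ) (w : M → ℍ[ℝ]), IsRiccati f N H ρ w ∧ ∀ p, F p = affine (f p + (w p)⁻¹) := by
  obtain ⟨α, φ, hα, hφ, hFφ⟩ := hF
  set a := (μ + μ⁻¹ - 2) / 2 with ha
  set b := (μ⁻¹ - μ) / 2 with hb
  have ha0 : a ≠ 0 := spectral_ne_zero h0 h1
  have hab : b ^ 2 = a ^ 2 + 2 * a := spectral_sq h0
  have hφ1 : ∀ p, (φ p).1 = α p + f p * (φ p).2 := by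
    intro p
    have := mem_affine_iff.1 (hφ.lift p)
    simp only [Prod.fst_sub, Prod.snd_sub, sub_zero] at this
    rw [← this]; module
  have hDα : ∀ p X, D α p X = -(D f p X * (φ p).2) := by
    intro p X
    have h2 := mem_affine_iff.1 (hφ.deriv p X)
    rw [D_fst hφ.smooth, D_snd hφ.smooth, show (fun p => (φ p).1) = _ from funext hφ1,
      D_add hα.smooth (hf.smooth.mul hφ.smooth.snd), D_mul hf.smooth hφ.smooth.snd] at h2
    linear_combination (norm := module) h2
  have hβ : ∀ p, (φ p).2 = (H / 2) • (a • (N p * α p) + b • (α p * quatI)) := by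
    intro p
    have h2 := hα.parallel p 1
    rw [nablaMu_eq hf, hDα, neg_add_eq_zero] at h2
    exact mul_left_cancel₀ (hf.D_ne_zero p one_ne_zero) h2
  -- At a zero of α the component β vanishes too, and then the prolongation would not span a line.
  have hα0 : ∀ p, α p ≠ 0 := by
    intro p hp
    obtain ⟨hne, -⟩ := hFφ p
    have h2 : (φ p).2 = 0 := by rw [hβ, hp]; simp
    exact hne (Prod.ext (by rw [hφ1, hp, h2]; simp) h2)
  set n : M → ℍ[ℝ] := fun p => α p * quatI * (α p)⁻¹ with hn
  set w : M → ℍ[ℝ] := fun p => (H / 2) • (a • N p + b • n p) with hw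
  have hns : IsSmooth n := (hα.smooth.mul (isSmooth_const quatI)).mul (hα.smooth.inv hα0)
  have hws : IsSmooth w := ((hf.smoothN.const_smul a).add (hns.const_smul b)).const_smul (H / 2)
  have hwα : ∀ p, w p * α p = (φ p).2 := by
    intro p
    rw [hβ]
    simp only [hw, hn, smul_mul_assoc, add_mul]
    rw [inv_mul_cancel_right₀ (hα0 p)]
  have hnn : ∀ p, n p * n p = -1 := by
    intro p
    simp only [hn, mul_assoc, inv_mul_cancel_left₀ (hα0 p)]
    rw [← mul_assoc quatI, quatI_mul_self]
    simp [mul_inv_cancel₀ (hα0 p)]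
  -- The mixed terms in N and n match on both sides; the rest is n² = N² = -1 together with b² = a²
  -- + 2a.
  have hint : ∀ p, w p * w p + (a * H ^ 2 / 2) • 1 =
      (a * H ^ 2 / 2 / H) • (w p * N p + N p * w p) := by
    intro p
    have h2 : a * H ^ 2 / 2 / H = a * H / 2 := by field_simp
    rw [h2]
    simp only [hw, smul_mul_assoc, mul_smul_comm, add_mul, mul_add, smul_add, smul_smul, hnn,
      hf.sqN, smul_neg, ← neg_smul]
    have h5 : (H ^ 2 / 4 * (b ^ 2)) • (1 : ℍ[ℝ]) = (H ^ 2 / 4 * (a ^ 2 + 2 * a)) • 1 := by rw [hab]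
    linear_combination (norm := module) -h5
  have hDn : ∀ p X, D n p X = n p * (D f p X * w p) - D f p X * w p * n p := by
    intro p X
    rw [hn, D_mul (hα.smooth.mul (isSmooth_const quatI)) (hα.smooth.inv hα0),
      D_mul hα.smooth (isSmooth_const quatI), D_const, D_inv hα.smooth hα0, hDα, ← hwα]
    simp only [mul_zero, zero_add, mul_neg, neg_mul, neg_neg, mul_assoc,
      mul_inv_cancel₀ (hα0 p), mul_one]
    module
  have hre : ∀ p, (w p).re = 0 := by
    intro p
    have h2 : (n p).re = 0 := re_eq_zero_of_sq (hnn p)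
    simp [hw, hf.reN, h2]
  have hρ : a * H ^ 2 / 2 ≠ 0 := by positivity
  -- A zero of w would reduce the first integral to ρ = 0.
  have hw0 : ∀ p, w p ≠ 0 := by
    intro p h2
    have h3 := hint p
    rw [h2] at h3
    simp [ha0, hH] at h3
  refine ⟨a * H ^ 2 / 2, w, ⟨hws, hre, hw0, hρ, fun p X => ?_, hint⟩, fun p => ?_⟩
  · have h2 : b • n p = (2 / H) • w p - a • N p := by
      simp only [hw, smul_smul]
      rw [show 2 / H * (H / 2) = 1 by field_simp]
      module
    have h3 := riccati_algebra hH rfl (hf.anticomm p X) (hint p)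
    rw [← h2] at h3
    have hDw : D w p X = (H / 2) • (a • D N p X + b • D n p X) := by
      rw [hw, D_const_smul _ ((hf.smoothN.const_smul a).add (hns.const_smul b)),
        D_add (hf.smoothN.const_smul a) (hns.const_smul b), D_const_smul _ hf.smoothN,
        D_const_smul _ hns]
    rw [hDw, hDn, hf.D_normal hH]
    have h4 : b • (n p * (D f p X * w p) - D f p X * w p * n p) =
        b • n p * (D f p X * w p) - D f p X * w p * b • n p := by
      rw [smul_mul_assoc (r := b), mul_smul_comm (s := b), smul_sub]
    have h5 : ∀ x : ℍ[ℝ], (H / 2) • (2 / H) • x = x := fun x => by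
      rw [smul_smul, show H / 2 * (2 / H) = 1 by field_simp, one_smul]
    rw [h4, h3, smul_add, smul_add, h5]
    module
  · obtain ⟨hne, h2⟩ := hFφ p
    rw [h2, eq_comm, affine_eq_mk_iff, ← hwα, hφ1, ← hwα, add_mul, inv_mul_cancel_left₀ (hw0 p)]
    module

theorem IsRiccati.isMuDarboux [SimplyConnectedSpace M] (hf : IsCMCImmersion f N H) (hH : H ≠ 0)
    {ρ : ℝ} {w : M → ℍ[ℝ]} (hw : IsRiccati f N H ρ w) :
    ∃ μ : ℝ, μ ≠ 0 ∧ μ ≠ 1 ∧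
      IsMuDarboux f N (μ : ℂ) (fun p => affine (f p + (w p)⁻¹)) := by
  obtain ⟨a, ha⟩ : ∃ a : ℝ, ρ = a * H ^ 2 / 2 := ⟨2 * ρ / H ^ 2, by field_simp⟩
  have ha0 : a ≠ 0 := by
    rintro rfl
    exact hw.rho (by simp [ha])
  set m : M → ℍ[ℝ] := fun p => (2 / H) • w p - a • N p with hm
  have hms : IsSmooth m := (hw.smooth.const_smul _).sub (hf.smoothN.const_smul _)
  have hmm : ∀ p, m p * m p = -((a ^ 2 + 2 * a) • 1) := by
    intro p
    have h1 : (2 / H * (2 / H)) • (w p * w p + ρ • (1 : ℍ[ℝ])) =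
        (2 / H * (2 / H)) • ((ρ / H) • (w p * N p + N p * w p)) := by rw [hw.integral]
    have h2 : 2 / H * (2 / H) * (ρ / H) = a * (2 / H) := by rw [ha]; field_simp
    have h3 : 2 / H * (2 / H) * ρ = 2 * a := by rw [ha]; field_simp
    simp only [smul_add, smul_smul, h2, h3] at h1
    simp only [hm, sub_mul, mul_sub, smul_mul_assoc, mul_smul_comm, hf.sqN]
    linear_combination (norm := module) h1
  obtain ⟨p₀⟩ : Nonempty M := inferInstance
  -- The quaternion m is imaginary, so m² = -(a² + 2a) is nonpositive; this is why the spectral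
  -- parameter is real.
  have hpos : 0 ≤ a ^ 2 + 2 * a := by
    have hre : (m p₀).re = 0 := by simp [hm, hw.re, hf.reN]
    have h1 := congrArg QuaternionAlgebra.re ((mul_self_eq_coe_of_re hre).symm.trans (hmm p₀))
    rw [Quaternion.re_coe] at h1
    simp at h1
    nlinarith [sq_nonneg ‖m p₀‖]
  obtain ⟨μ, hμ0, hμ1, hμa, hμb⟩ := exists_spectral_parameter ha0 hpos
  set b := (μ⁻¹ - μ) / 2 with hb
  have hDw : ∀ p X Y, D f p X * D w p Y - D f p Y * D w p X
      + D f p Y * w p * (D f p X * w p) - D f p X * w p * (D f p Y * w p) = 0 := by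
    -- The contribution of dg vanishes by df ∧ dg = 0, and the cubic terms from w df w cancel the
    -- curvature of df w.
    intro p X Y
    rw [hw.deriv, hw.deriv, mul_add, mul_add, mul_smul_comm, mul_smul_comm,
      hf.D_wedge_parallel hH p X Y]
    noncomm_ring
  obtain ⟨c, hc0, hc⟩ := exists_conj_quatI (m := m p₀) (b := b) (by rw [hmm, hμb])
  obtain ⟨α, hαs, hαp, hα0, hα⟩ := exists_parallel hf.smooth hw.smooth hDw p₀ c
  have hα0 := hα0 hc0
  have hDm : ∀ p X, D m p X = m p * (D f p X * w p) - D f p X * w p * m p := by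
    intro p X
    rw [hm, D_sub (hw.smooth.const_smul _) (hf.smoothN.const_smul _), D_const_smul _ hw.smooth,
      D_const_smul _ hf.smoothN, hw.deriv, hf.D_normal hH,
      riccati_algebra hH ha (hf.anticomm p X) (hw.integral p), ha, smul_add, smul_smul,
      show 2 / H * (a * H ^ 2 / 2) = a * H by field_simp]
    module
  -- The defect of the eigenvalue relation solves the same linear system as α, so α⁻¹e is constant;
  -- it vanishes at p₀ by the choice of c.
  set e : M → ℍ[ℝ] := fun p => m p * α p - b • (α p * quatI) with he
  have hαi : IsSmooth (fun p => α p * quatI) := hαs.mul (isSmooth_const quatI)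
  have hes : IsSmooth e := (hms.mul hαs).sub (hαi.const_smul b)
  have hDe : ∀ p X, D e p X = -(D f p X * w p * e p) := by
    intro p X
    rw [he, D_sub (hms.mul hαs) (hαi.const_smul b), D_mul hms hαs, D_const_smul _ hαi,
      D_mul hαs (isSmooth_const quatI), D_const, hα, hDm]
    simp only [mul_sub, sub_mul, mul_neg, neg_mul, mul_zero, mul_smul_comm, mul_assoc]
    module
  have he0 : ∀ p, e p = 0 := by
    intro p
    have h1 : ∀ q, D (fun q => (α q)⁻¹ * e q) q = 0 := by
      intro q
      ext1 X
      rw [D_mul (hαs.inv hα0) hes, D_inv hαs hα0, hDe, hα]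
      simp only [mul_neg, neg_mul, neg_neg, mul_assoc, mul_inv_cancel_left₀ (hα0 q)]
      simp
    have h2 := eq_of_D_eq_zero ((hαs.inv hα0).mul hes) h1 p p₀
    have h3 : e p₀ = 0 := by simp only [he, hαp, hc, sub_self]
    rw [h3, mul_zero] at h2
    exact (mul_eq_zero.1 h2).resolve_left (inv_ne_zero (hα0 p))
  have hβs : IsSmooth (fun p => w p * α p) := hw.smooth.mul hαs
  have hφs : IsSmooth (fun p => ((α p + f p * (w p * α p), w p * α p) : H2)) :=
    (hαs.add (hf.smooth.mul hβs)).prodMk hβs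
  refine ⟨μ, hμ0, hμ1, α, fun p => (α p + f p * (w p * α p), w p * α p),
    ⟨hαs, ⟨p₀, hα0 p₀⟩, fun p X => ?_⟩, ⟨hφs, fun p => ?_, fun p X => ?_⟩, fun p => ?_⟩
  · rw [nablaMu_eq hf, hα, hμa, ← hb]
    have h1 : m p * α p = b • (α p * quatI) := sub_eq_zero.1 (he0 p)
    rw [← h1]
    simp only [hm, sub_mul, smul_mul_assoc]
    rw [add_sub_cancel, smul_smul, show H / 2 * (2 / H) = 1 by field_simp, one_smul, mul_assoc]
    exact neg_add_cancel _
  · rw [mem_affine_iff]; simp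
  · rw [mem_affine_iff, D_fst hφs, D_snd hφs, D_add hαs (hf.smooth.mul hβs),
      D_mul hf.smooth hβs, hα]
    noncomm_ring
  · have hne : ((α p + f p * (w p * α p), w p * α p) : H2) ≠ 0 := fun h =>
      mul_ne_zero (hw.ne_zero p) (hα0 p) (congrArg Prod.snd h)
    refine ⟨hne, ?_⟩
    rw [affine_eq_mk_iff, add_mul, inv_mul_cancel_left₀ (hw.ne_zero p)]
    module

end SpectralFamily

/-! ### Algebraic identities for the converse. -/

section ConverseAlgebra

theorem re_inv_eq_zero {x : ℍ[ℝ]} (h : x.re = 0) : (x⁻¹).re = 0 := by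
  rw [Quaternion.inv_def]; simp [h]

/-- The hypotheses `h1` and `h2` are the derivative of wN♯ + Nw = 0 along X and iX, and η = dw - w
df w. Half of h1 + n·h2 is one type component: the terms in df cancel and `hm` eliminates the
derivatives of N♯. -/
theorem normal_compat_algebra {H Hs : ℝ} {w m n F G Φ η A B : ℍ[ℝ]} (hw : w * m = -(n * w))
    (hn : n * n = -1) (hF : n * F = -(F * n)) (hm : A - m * B = -((2 * Hs) • Φ))
    (h1 : (w * F * w + η) * m + w * A + ((H • G - H • F) * w + n * (w * F * w + η)) = 0)
    (h2 : (w * (n * F) * w - n * η) * m + w * B +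
      ((-(H • (n * G)) - H • (n * F)) * w + n * (w * (n * F) * w - n * η)) = 0) :
    η * m + n * η - Hs • (w * Φ) + H • (G * w) = 0 := by
  have hn' : ∀ x, n * (n * x) = -x := fun x => by rw [← mul_assoc, hn]; simp
  have hF' : F * n = -(n * F) := by rw [hF, neg_neg]
  have hFx : ∀ x, F * (n * x) = -(n * (F * x)) := fun x => by
    rw [← mul_assoc, hF', neg_mul, mul_assoc]
  have hwx : ∀ x, w * (m * x) = -(n * (w * x)) := fun x => by
    rw [← mul_assoc, hw, neg_mul, mul_assoc]
  have h3 : w * A = w * (m * B) - (2 * Hs) • (w * Φ) := by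
    rw [← mul_smul_comm, ← mul_sub]
    congr 1
    linear_combination (norm := module) hm
  have h4 := congrArg (n * ·) h2
  simp only [h3, hwx, mul_add, add_mul, mul_sub, sub_mul, mul_assoc, hw, mul_neg, neg_mul, hFx, hn',
    smul_mul_assoc, mul_smul_comm, mul_zero, neg_neg, smul_neg] at h1 h4
  linear_combination (norm := module) (1 / 2 : ℝ) • h1 + (1 / 2 : ℝ) • h4

/-- Differentiating w² = r(wN + Nw) - rH♯ with the Riccati equation inserted. All terms in dg cancel
because s = wN + Nw is real, and only the discrepancy of the mean curvatures remains. -/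
theorem first_integral_algebra {H Hs r s : ℝ} {w n F G : ℍ[ℝ]}
    (hF : n * F = -(F * n)) (hG : n * G = -(G * n)) (hs : w * n + n * w = s • 1)
    (hww : w * w = (r * (s - Hs)) • 1)
    (hd : (w * F * w + (r * H) • G) * w + w * (w * F * w + (r * H) • G) =
      r • ((w * F * w + (r * H) • G) * n + w * (H • G - H • F) +
        ((H • G - H • F) * w + n * (w * F * w + (r * H) • G)))) :
    (r * (Hs - H)) • (w * F + F * w) = 0 := by
  have a1 : w * F * w * w = (r * (s - Hs)) • (w * F) := by
    rw [mul_assoc, hww, mul_smul_comm, mul_one]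
  have a2 : w * (w * F * w) = (r * (s - Hs)) • (F * w) := by
    rw [mul_assoc, ← mul_assoc w w, hww, smul_mul_assoc, one_mul]
  have a3 : w * F * w * n + n * (w * F * w) = s • (w * F + F * w) := by
    have b1 : w * F * (w * n + n * w) = s • (w * F) := by rw [hs, mul_smul_comm, mul_one]
    have b2 : (w * n + n * w) * (F * w) = s • (F * w) := by rw [hs, smul_mul_assoc, one_mul]
    have b3 : w * (n * F + F * n) * w = 0 := by rw [hF]; simp
    linear_combination (norm := skip) b1 + b2 - b3
    simp only [mul_add, add_mul, smul_add, mul_assoc]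
    module
  have a4 : G * n = -(n * G) := by rw [hG, neg_neg]
  simp only [add_mul, mul_add, sub_mul, mul_sub, smul_mul_assoc, mul_smul_comm, a1, a2, a4] at hd
  linear_combination (norm := module) -hd - r • a3

theorem frequently_nhds {X : Type*} [TopologicalSpace X] {p : X} [(𝓝[≠] p).NeBot] {P : X → Prop}
    (h : ∀ᶠ q in 𝓝[≠] p, P q) : ∃ᶠ q in 𝓝 p, P q :=
  h.frequently.filter_mono nhdsWithin_le_nhds

/-- Carries identities across branch points from the dense set where a differential does not vanish.
-/
theorem continuous_eq_zero_of_frequently {X E : Type*} [TopologicalSpace X] [TopologicalSpace E]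
    [T1Space E] [Zero E] {a : X → E} {p : X} (ha : ContinuousAt a p) {P : X → Prop}
    (hP : ∀ q, P q → a q = 0) (h : ∃ᶠ q in 𝓝 p, P q) : a p = 0 := by
  by_contra hne
  exact h ((ha.eventually_ne hne).mono fun q hq hPq => hq (hP q hPq))

end ConverseAlgebra

/-! ### What a common sphere congruence and constant mean curvature imply. -/

section ConverseSurface

variable {M : Type*} [TopologicalSpace M] [ChartedSpace ℂ M] [IsManifold 𝓘(ℂ, ℂ) ω M]
variable {f N : M → ℍ[ℝ]} {H : ℝ}

/-- A sphere congruence enveloping a surface acts on its line bundle by the normal. -/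
theorem envelopes_normal {S : M → (H2 →ₗ[(ℍ[ℝ])ᵐᵒᵖ] H2)} (hS : IsSphereCongruence S)
    {h n : M → ℍ[ℝ]} (hh : IsSmooth h) (hn : IsSmooth n)
    (hright : ∀ p X, starD h p X = -(D h p X * n p)) (hdense : ∀ p, ∃ᶠ q in 𝓝 p, D h q ≠ 0)
    (he : Envelopes S (fun p => affine (h p))) (p : M) :
    S p (h p, 1) = (-(h p * n p), -n p) := by
  have e : ∀ q, S q (h q, 1) = ((S q (1, 0)).1 * h q + (S q (0, 1)).1,
      (S q (1, 0)).2 * h q + (S q (0, 1)).2) := fun q => by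
    have h1 : ((h q, 1) : H2) = MulOpposite.op (h q) • ((1, 0) : H2) + (0, 1) := by
      apply Prod.ext <;> simp [MulOpposite.smul_eq_mul_unop]
    rw [h1, map_add, map_smul]
    apply Prod.ext <;> simp [MulOpposite.smul_eq_mul_unop]
  have hsm : IsSmooth fun q => S q (h q, 1) := by
    rw [funext e]
    exact (((hS.smooth (1, 0)).fst.mul hh).add (hS.smooth (0, 1)).fst).prodMk
      (((hS.smooth (1, 0)).snd.mul hh).add (hS.smooth (0, 1)).snd)
  have hσ : IsSection (fun p => affine (h p)) fun q => (h q, 1) :=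
    ⟨hh.prodMk (isSmooth_const 1), fun q => mem_affine_iff.2 (by simp)⟩
  have hmem : ∀ q, (S q (h q, 1)).1 = h q * (S q (h q, 1)).2 := fun q => by
    rw [← mem_affine_iff]
    have := Submodule.mem_map_of_mem (f := S q) (hσ.2 q)
    rwa [he.map_line q] at this
  -- Write S(h, 1) = (hy, y). Comparing *δ with δS modulo the line gives dh (y + n) = 0.
  have hy : ∀ q, D h q ≠ 0 → (S q (h q, 1)).2 + n q = 0 := by
    intro q hq
    obtain ⟨X, hX⟩ : ∃ X, D h q X ≠ 0 := by
      by_contra! hcon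
      exact hq (ContinuousLinearMap.ext hcon)
    have h1 := Submodule.add_mem _ (he.star_eq_left _ hσ q X) (he.left_eq_right _ hσ q X)
    rw [sub_add_sub_cancel, mem_affine_iff, Prod.fst_sub, Prod.snd_sub, starD, D_fst hσ.1,
      D_snd hσ.1, D_fst hsm, D_snd hsm] at h1
    simp only [D_const, funext hmem] at h1
    rw [D_mul hh hsm.snd] at h1
    have h2 := hright q X
    rw [starD] at h2
    rw [h2] at h1
    have h3 : D h q X * ((S q (h q, 1)).2 + n q) = 0 := by
      linear_combination (norm := noncomm_ring) -h1
    exact (mul_eq_zero.1 h3).resolve_left hX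
  have h4 : (S p (h p, 1)).2 + n p = 0 :=
    continuous_eq_zero_of_frequently (a := fun p => (S p (h p, 1)).2 + n p)
      ((hsm.snd.add hn).continuous.continuousAt (x := p)) hy
      (hdense p)
  have h5 := eq_neg_of_add_eq_zero_left h4
  refine Prod.ext ?_ h5
  rw [hmem, h5, mul_neg]

theorem IsConformalMap.frequently_D_ne_zero {f : M → ℍ[ℝ]} (hf : IsConformalMap f) (p : M) :
    ∃ᶠ q in 𝓝 p, D f q ≠ 0 :=
  have := nhdsNE_neBot p
  frequently_nhds (hf.isolated p)

/-- The normals of a surface and of its classical Darboux transforms are related by a reflection. -/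
theorem normal_of_classicalDarboux (hf : IsCMCImmersion f N H) {fs Ns : M → ℍ[ℝ]}
    (hd : IsClassicalDarboux f fs) (hN : IsGaussMap fs Ns) {w : M → ℍ[ℝ]}
    (hw : ∀ p, w p * (fs p - f p) = 1) (p : M) : N p = -((fs p - f p) * Ns p * w p) := by
  obtain ⟨S, hS, h1, h2⟩ := hd.sphere
  have hw' : ∀ p, (fs p - f p) * w p = 1 := fun p => mul_eq_one_comm.1 (hw p)
  have hF := hf.D_ne_zero p one_ne_zero
  have a1 := envelopes_normal hS hf.smooth hf.smoothN hf.mean.1.right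
    (fun q => (Filter.Eventually.of_forall fun q h =>
      hf.D_ne_zero q one_ne_zero (by rw [h]; rfl)).frequently) h1 p
  have a2 := envelopes_normal hS hd.conformal.smooth hN.smooth hN.right
    hd.conformal.frequently_D_ne_zero h2 p
  have hσ : IsSection (fun p => affine (f p)) fun q => (f q, 1) :=
    ⟨hf.smooth.prodMk (isSmooth_const 1), fun q => mem_affine_iff.2 (by simp)⟩
  have h3 := h1.star_eq_left _ hσ p 1
  have e1 : ∀ X, D (fun q => ((f q, 1) : H2)) p X = (D f p X, 0) := fun X =>
    Prod.ext (by rw [D_fst hσ.1]) (by rw [D_snd hσ.1, D_const])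
  -- The derivative of the section is expressed in the basis (f, 1), (f♯, 1), where the action of S
  -- is known; *δ = Sδ on the line of f then gives the relation of the normals.
  have e2 : ((D f p 1, 0) : H2) =
      MulOpposite.op (w p * D f p 1) • (((fs p, 1) : H2) - (f p, 1)) := by
    apply Prod.ext
    · simp only [Prod.smul_fst, Prod.fst_sub, MulOpposite.smul_eq_mul_unop, MulOpposite.unop_op]
      rw [← mul_assoc, hw', one_mul]
    · simp
  rw [starD, e1, e1, hf.D_I, e2, map_smul, map_sub, a1, a2, mem_affine_iff] at h3
  simp only [Prod.smul_fst, Prod.fst_sub, Prod.smul_snd, Prod.snd_sub,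
    MulOpposite.smul_eq_mul_unop, MulOpposite.unop_op] at h3
  have h4 : (N p + (fs p - f p) * Ns p * w p) * D f p 1 = 0 := by
    linear_combination (norm := noncomm_ring) h3
  exact eq_neg_of_add_eq_zero_left ((mul_eq_zero.1 h4).resolve_right hF)

theorem mul_add_mul_eq_smul_one {a b : ℍ[ℝ]} (ha : a.re = 0) (hb : b.re = 0) :
    a * b + b * a = (a * b + b * a).re • (1 : ℍ[ℝ]) := by
  apply Quaternion.ext <;> simp [ha, hb] <;> ring

theorem IsSmooth.re {a : M → ℍ[ℝ]} (ha : IsSmooth a) : IsSmooth fun p => (a p).re := by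
  have h : (fun p => (a p).re) = fun p => innerSL ℝ (1 : ℍ[ℝ]) (a p) :=
    funext fun p => by simp [Quaternion.inner_def]
  rw [h]
  exact ha.comp_contDiff (innerSL ℝ (1 : ℍ[ℝ])).contDiff

/-- A Darboux transform `f + w⁻¹` of constant mean curvature satisfies a Riccati equation whose
coefficient is determined by the first integral. -/
theorem exists_riccati_coefficient (hf : IsCMCImmersion f N H) (hH : H ≠ 0) {w Ns : M → ℍ[ℝ]}
    {Hs : ℝ} (hw : IsSmooth w) (hre : ∀ p, (w p).re = 0) (h0 : ∀ p, w p ≠ 0)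
    (hN : HasMeanCurvature (fun p => f p + (w p)⁻¹) Ns Hs)
    (hNs : ∀ p, N p = -((w p)⁻¹ * Ns p * w p)) :
    ∃ r : M → ℝ, IsSmooth r ∧
      (∀ p X, r p • (D w p X - w p * D f p X * w p) + H • D (parallelSurface f N H) p X = 0) ∧
      ∀ p, r p • (w p * w p) = Hs • 1 - (w p * N p + N p * w p) := by
  have hm : ∀ p, w p * Ns p = -(N p * w p) := fun p => by
    have h1 := hNs p
    rw [conj_inv_comm (hre p) (h0 p)] at h1
    rw [h1, neg_mul, neg_neg, inv_mul_cancel_right₀ (h0 p)]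
  have hm' : ∀ p, Ns p * (w p)⁻¹ = -((w p)⁻¹ * N p) := fun p => by
    have h1 : Ns p = -((w p)⁻¹ * N p * w p) := by
      rw [mul_assoc, ← neg_eq_iff_eq_neg.2 (hm p), mul_neg, neg_neg, inv_mul_cancel_left₀ (h0 p)]
    rw [h1, neg_mul, mul_inv_cancel_right₀ (h0 p)]
  -- The factor R arises by moving every term of the compatibility identity, times w⁻¹, to the right
  -- of η. It is real, since w⁻² and the anticommutator of imaginary quaternions are.
  set R : M → ℍ[ℝ] := fun p => Hs • ((w p)⁻¹ * (w p)⁻¹) - ((w p)⁻¹ * N p + N p * (w p)⁻¹) with hR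
  have hRs : IsSmooth R :=
    (((hw.inv h0).mul (hw.inv h0)).const_smul _).sub
      (((hw.inv h0).mul hf.smoothN).add (hf.smoothN.mul (hw.inv h0)))
  have hRr : ∀ p, R p = (R p).re • (1 : ℍ[ℝ]) := fun p => by
    have i0 := re_inv_eq_zero (hre p)
    have h1 := mul_add_mul_eq_smul_one i0 (hf.reN p)
    obtain ⟨b, hb⟩ : ∃ b : ℝ, (w p)⁻¹ * (w p)⁻¹ = b := ⟨_, mul_self_eq_coe_of_re i0⟩
    simp only [hR]
    rw [h1, hb]
    apply Quaternion.ext <;> simp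
  have hT : IsSmooth fun p => f p + (w p)⁻¹ := hf.smooth.add (hw.inv h0)
  refine ⟨fun p => (R p).re, hRs.re, fun p X => ?_, fun p => ?_⟩
  · have hΦ : ∀ X, D w p X - w p * D f p X * w p =
        -(w p * D (fun p => f p + (w p)⁻¹) p X * w p) := fun X => by
      rw [D_add hf.smooth (hw.inv h0), D_inv hw h0]
      simp only [mul_add, add_mul, mul_neg, neg_mul, mul_assoc, inv_mul_cancel₀ (h0 p), mul_one,
        mul_inv_cancel_left₀ (h0 p)]
      abel
    set Φ := D (fun p => f p + (w p)⁻¹) p X with hΦd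
    have hΦI : D (fun p => f p + (w p)⁻¹) p (Complex.I * X) = Ns p * Φ := hN.1.left p X
    have hΦr : Ns p * Φ = -(Φ * Ns p) := (hN.1.left p X).symm.trans (hN.1.right p X)
    have hD : ∀ X, D w p X * Ns p + w p * D Ns p X + (D N p X * w p + N p * D w p X) = 0 := by
      intro X
      have h1 : (fun p => w p * Ns p + N p * w p) = fun _ => (0 : ℍ[ℝ]) :=
        funext fun p => by rw [hm p, neg_add_cancel]
      have h2 := D_add (hw.mul hN.1.smooth) (hf.smoothN.mul hw) p X
      rw [h1, D_const, D_mul hw hN.1.smooth, D_mul hf.smoothN hw] at h2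
      linear_combination (norm := module) -h2
    have hmc : D Ns p X - Ns p * D Ns p (Complex.I * X) = -((2 * Hs) • Φ) := by
      have := hN.2 p X
      rw [dNormalPrime, starD] at this
      linear_combination (norm := module) (2 : ℝ) • this
    set η := D w p X - w p * D f p X * w p with hη
    have e0 : η = -(w p * Φ * w p) := hΦ X
    have e1 : D w p X = w p * D f p X * w p + η := by rw [hη]; abel
    have hηN : η * N p = -(N p * η) := by
      have h1 : w p * N p = -(Ns p * w p) := by
        rw [hNs p]; simp only [mul_neg, mul_assoc, mul_inv_cancel_left₀ (h0 p)]
      rw [e0]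
      simp only [neg_mul, mul_neg, mul_assoc, h1, neg_neg]
      rw [← mul_assoc (N p), ← neg_eq_iff_eq_neg.2 (hm p), neg_mul, mul_assoc, ← mul_assoc (Ns p),
        hΦr]
      simp only [neg_mul, mul_neg, mul_assoc, neg_neg]
    have e2 : D w p (Complex.I * X) = w p * (N p * D f p X) * w p - N p * η := by
      have h1 := hΦ (Complex.I * X)
      rw [hf.D_I, hΦI, ← mul_assoc (w p) (Ns p), hm] at h1
      rw [e0]
      linear_combination (norm := noncomm_ring) h1
    have h1 := hD X
    have h2 := hD (Complex.I * X)
    rw [e1, hf.D_normal hH] at h1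
    rw [e2, hf.D_normal hH, hf.D_I, hf.D_parallel_I hH, smul_neg] at h2
    have h3 := normal_compat_algebra (hm p) (hf.sqN p) (hf.anticomm p X) hmc h1 h2
    have h4 : w p * Φ = -(η * (w p)⁻¹) := by
      rw [e0, neg_mul, neg_neg, mul_inv_cancel_right₀ (h0 p)]
    have h5 : η * R p + H • D (parallelSurface f N H) p X = 0 := by
      have h6 := congrArg (· * (w p)⁻¹) h3
      simp only [add_mul, sub_mul, smul_mul_assoc, mul_assoc, mul_inv_cancel₀ (h0 p), hm', mul_one,
        zero_mul, mul_neg] at h6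
      rw [← mul_assoc (w p), h4, ← mul_assoc (N p), ← neg_eq_iff_eq_neg.2 hηN] at h6
      simp only [hR, mul_sub, mul_add, mul_smul_comm]
      simp only [neg_mul, smul_neg, mul_assoc] at h6
      linear_combination (norm := module) h6
    rw [hRr, mul_smul_comm, mul_one] at h5
    exact h5
  · have h1 : w p * R p * w p = Hs • 1 - (w p * N p + N p * w p) := by
      simp only [hR, mul_sub, sub_mul, mul_add, add_mul, mul_smul_comm, smul_mul_assoc, mul_assoc,
        inv_mul_cancel₀ (h0 p), mul_inv_cancel_left₀ (h0 p), mul_one]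
      abel
    rw [hRr] at h1
    simpa using h1

/-- The integrability condition of the equation `r (dw - w df w) + H dg = 0`. -/
theorem riccati_integrability {r : M → ℝ} {w f g : M → ℍ[ℝ]} (hr : IsSmooth r) (hw : IsSmooth w)
    (hf : IsSmooth f) (hg : IsSmooth g)
    (h : ∀ p X, r p • (D w p X - w p * D f p X * w p) + H • D g p X = 0) (p : M) (X Y : ℂ) :
    D r p X • (D w p Y - w p * D f p Y * w p) - D r p Y • (D w p X - w p * D f p X * w p) +
      r p • (D w p Y * D f p X * w p + w p * D f p X * D w p Y -
        D w p X * D f p Y * w p - w p * D f p Y * D w p X) = 0 := by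
  have hloc : ∀ X, ∀ᶠ z in 𝓝 (chartAt ℂ p p), loc r p z • (fderiv ℝ (loc w p) z X -
      loc w p z * fderiv ℝ (loc f p) z X * loc w p z) + H • fderiv ℝ (loc g p) z X = 0 := by
    intro X
    filter_upwards [(chartAt ℂ p).open_target.mem_nhds (mem_chart_target ℂ p)] with z hz
    rw [fderiv_loc_eq_D hw hz, fderiv_loc_eq_D hf hz, fderiv_loc_eq_D hg hz]
    exact h _ _
  have hw1 := hasFDerivAt_loc hw p
  have hp := mem_chart_target ℂ p
  have key : ∀ X Y, D r p Y • (D w p X - w p * D f p X * w p) +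
      r p • (fderiv ℝ (fderiv ℝ (loc w p)) (chartAt ℂ p p) Y X -
        (w p * D f p X * D w p Y +
          (w p * fderiv ℝ (fderiv ℝ (loc f p)) (chartAt ℂ p p) Y X + D w p Y * D f p X) * w p)) +
      H • fderiv ℝ (fderiv ℝ (loc g p)) (chartAt ℂ p p) Y X = 0 := by
    intro X Y
    have h1 := ((hasFDerivAt_loc hr p).smul ((hasFDerivAt_fderiv_loc hw p hp X).sub
      ((hw1.mul' (hasFDerivAt_fderiv_loc hf p hp X)).mul' hw1))).add
      ((hasFDerivAt_fderiv_loc hg p hp X).const_smul H)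
    have h2 := h1.unique ((hasFDerivAt_const (0 : ℍ[ℝ]) _).congr_of_eventuallyEq (hloc X))
    have h3 := DFunLike.congr_fun h2 Y
    simp only [← D_eq_fderiv_loc hf, loc_apply_self] at h3
    simp at h3
    simp only [← D_eq_fderiv_loc hw, ← D_eq_fderiv_loc hf, loc_apply_self] at h3
    simp only [add_mul]
    linear_combination (norm := module) h3
  -- Subtracting the two orders of differentiation removes the second derivatives of w, f and g.
  have k1 := key Y X
  have k2 := key X Y
  rw [fderiv_fderiv_loc_symm hw p (mem_chart_target ℂ p),
    fderiv_fderiv_loc_symm hf p (mem_chart_target ℂ p),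
    fderiv_fderiv_loc_symm hg p (mem_chart_target ℂ p)] at k1
  simp only [add_mul] at k1 k2
  linear_combination (norm := module) k1 - k2

end ConverseSurface

/-! ### Constancy of the Riccati coefficient and equality of the mean curvatures. -/

section Converse

variable {M : Type*} [TopologicalSpace M] [ChartedSpace ℂ M] [IsManifold 𝓘(ℂ, ℂ) ω M]
variable {f N : M → ℍ[ℝ]} {H : ℝ}

/-- Off the zeros of `dg`, the coefficient of the Riccati equation is locally constant. -/
theorem D_coefficient_eq_zero (hf : IsCMCImmersion f N H) (hH : H ≠ 0) {w : M → ℍ[ℝ]} {r : M → ℝ}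
    (hw : IsSmooth w) (hr : IsSmooth r)
    (h : ∀ p X, r p • (D w p X - w p * D f p X * w p) +
      H • D (parallelSurface f N H) p X = 0) {p : M}
    (hp : D (parallelSurface f N H) p ≠ 0) : D r p = 0 := by
  set g := parallelSurface f N H with hg
  have hG : ∀ X, X ≠ 0 → D g p X ≠ 0 := fun X hX h0 =>
    hp ((hf.D_parallel_eq_zero_iff hH p).2 ⟨X, hX, h0⟩)
  have hrp : r p ≠ 0 := fun h0 => by
    have := h p 1
    rw [h0, zero_smul, zero_add] at this
    exact hG 1 one_ne_zero ((smul_eq_zero.1 this).resolve_left hH)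
  set k := -(H / r p) with hk
  have hk0 : k ≠ 0 := neg_ne_zero.2 (div_ne_zero hH hrp)
  have hD : ∀ X, D w p X = w p * D f p X * w p + k • D g p X := fun X => by
    have h1 := congrArg ((r p)⁻¹ • ·) (h p X)
    simp only [smul_add, inv_smul_smul₀ hrp, smul_smul, smul_zero] at h1
    have h2 : k = -((r p)⁻¹ * H) := by rw [hk]; ring
    rw [h2]
    linear_combination (norm := module) h1
  have key : ∀ X Y, D r p X • D g p Y = D r p Y • D g p X := by
    intro X Y
    have h1 := riccati_integrability hr hw hf.smooth hf.smooth_parallel h p X Y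
    have w1 := hf.D_wedge_parallel hH p X Y
    have w2 := hf.D_parallel_wedge hH p X Y
    -- The cubic terms are symmetric in X and Y, and the terms in dg cancel by df ∧ dg = dg ∧ df =
    -- 0. Only dr ∧ dg = 0 remains of the integrability condition.
    have h2 : D w p Y * D f p X * w p + w p * D f p X * D w p Y -
        D w p X * D f p Y * w p - w p * D f p Y * D w p X = 0 := by
      rw [hD, hD]
      simp only [add_mul, mul_add, smul_mul_assoc, mul_smul_comm]
      linear_combination (norm := skip) k • ((w p : ℍ[ℝ]) • w1) - k • (w2 * w p)
      simp only [smul_eq_mul, ← hg, mul_assoc]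
      module
    rw [h2, smul_zero, add_zero, hD, hD, add_sub_cancel_left, add_sub_cancel_left, smul_comm _ k,
      smul_comm _ k, ← smul_sub] at h1
    exact sub_eq_zero.1 ((smul_eq_zero.1 h1).resolve_left hk0)
  ext1 X
  have k1 := key X (Complex.I * X)
  by_cases hX : X = 0
  · rw [hX, map_zero, map_zero]
  rw [hf.D_parallel_I hH, ← hg, smul_neg] at k1
  have hn := hf.reN p
  -- With Y = iX and *dg = -N dg, the factor of dg(X) has real part dr(iX) and imaginary part
  -- dr(X)N, so both vanish.
  have k2 : (D r p X • N p + D r p (Complex.I * X) • (1 : ℍ[ℝ])) * D g p X = 0 := by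
    rw [add_mul, smul_mul_assoc, smul_mul_assoc, one_mul, ← k1, add_neg_cancel]
  have k3 := (mul_eq_zero.1 k2).resolve_right (hG X hX)
  have k4 := congrArg QuaternionAlgebra.re k3
  simp [hn] at k4
  rw [k4, zero_smul, add_zero] at k3
  refine (smul_eq_zero.1 k3).resolve_right fun h0 => ?_
  have := hf.sqN p
  rw [h0] at this
  simp at this

/-- `D` is read in charts varying with the point, so continuity is applied to the derivative in the
fixed chart at `p`. -/
theorem D_eq_zero_of_frequently {E : Type*} [NormedAddCommGroup E] [NormedSpace ℝ E] {r : M → E}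
    (hr : IsSmooth r) {p : M} (h : ∃ᶠ q in 𝓝 p, D r q = 0) : D r p = 0 := by
  have hc : ContinuousAt (fun q => fderiv ℝ (loc r p) (chartAt ℂ p q)) p :=
    ContinuousAt.comp (contDiffAt_fderiv_loc hr p (mem_chart_target ℂ p)).continuousAt
      ((chartAt ℂ p).continuousAt (mem_chart_source ℂ p))
  rw [D_eq_fderiv_loc hr]
  refine continuous_eq_zero_of_frequently (a := fun q => fderiv ℝ (loc r p) (chartAt ℂ p q)) hc
    (P := fun q => D r q = 0 ∧ q ∈ (chartAt ℂ p).source) (fun q hq => ?_)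
    (h.and_eventually ((chartAt ℂ p).open_source.mem_nhds (mem_chart_source ℂ p)))
  ext1 X
  rw [fderiv_loc_eq_D hr ((chartAt ℂ p).map_source hq.2), (chartAt ℂ p).left_inv hq.2, hq.1]
  rfl

/-- The mean curvature of a constant mean curvature Darboux transform agrees with that of the
surface. -/
theorem meanCurvature_eq (hf : IsCMCImmersion f N H) (hH : H ≠ 0) {w : M → ℍ[ℝ]} {r Hs : ℝ}
    (hw : IsSmooth w) (hre : ∀ p, (w p).re = 0) (h0 : ∀ p, w p ≠ 0) (hr : r ≠ 0)
    (hd : ∀ p X, D w p X = w p * D f p X * w p + (r * H) • D (parallelSurface f N H) p X)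
    (hi : ∀ p, w p * w p = r • (w p * N p + N p * w p) - (r * Hs) • 1)
    {p : M} (hp : D (parallelSurface f N H) p ≠ 0) : Hs = H := by
  set g := parallelSurface f N H with hg
  by_contra hne
  have hwF : ∀ q X, w q * D f q X + D f q X * w q = 0 := by
    intro q X
    have hs := mul_add_mul_eq_smul_one (hre q) (hf.reN q)
    have h1 := D_mul hw hw q X
    have e : (fun q => w q * w q) = fun q => r • (w q * N q + N q * w q) - (r * Hs) • 1 := funext hi
    rw [e, D_sub (((hw.mul hf.smoothN).add (hf.smoothN.mul hw)).const_smul _) (isSmooth_const _),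
      D_const_smul _ ((hw.mul hf.smoothN).add (hf.smoothN.mul hw)),
      D_add (hw.mul hf.smoothN) (hf.smoothN.mul hw), D_mul hw hf.smoothN, D_mul hf.smoothN hw,
      D_const, hd, hf.D_normal hH, ← hg] at h1
    have h2 := first_integral_algebra (r := r) (H := H) (Hs := Hs) (hf.anticomm q X)
      (hf.anticomm_parallel q X) hs
      (by
        rw [hi]
        linear_combination (norm := module) r • hs) (by
        rw [← hg]
        linear_combination (norm := module) -h1)
    exact (smul_eq_zero.1 h2).resolve_left (mul_ne_zero hr (sub_ne_zero.2 hne))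
  -- If the mean curvatures differed, w would anticommute with df(1) and N df(1), hence commute with
  -- N and be a real multiple kN.
  have hc : ∀ q, w q * N q - N q * w q = 0 := by
    intro q
    have h1 := hwF q 1
    have h2 := hwF q (Complex.I * 1)
    rw [hf.D_I] at h2
    have h3 : (w q * N q - N q * w q) * D f q 1 = 0 := by
      linear_combination (norm := noncomm_ring) h2 - N q * h1
    exact (mul_eq_zero.1 h3).resolve_right (hf.D_ne_zero q one_ne_zero)
  obtain ⟨k, hk⟩ : ∃ k : ℝ, w p = k • N p := by
    have h1 := mul_add_mul_eq_smul_one (hre p) (hf.reN p)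
    have h2 := hc p
    refine ⟨-((w p * N p + N p * w p).re / 2), ?_⟩
    have h3 : w p * N p = ((w p * N p + N p * w p).re / 2) • (1 : ℍ[ℝ]) := by
      linear_combination (norm := module) (1 / 2 : ℝ) • h1 + (1 / 2 : ℝ) • h2
    have h4 := congrArg (· * N p) h3
    simp only [mul_assoc, hf.sqN, smul_mul_assoc, one_mul, mul_neg, mul_one] at h4
    rw [neg_smul, ← h4, neg_neg]
  have hk0 : k ≠ 0 := fun h => h0 p (by rw [hk, h, zero_smul])
  have hNN := hf.sqN p
  have hNNx : ∀ x, N p * (N p * x) = -x := fun x => by rw [← mul_assoc, hNN]; simp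
  have hN0 : N p ≠ 0 := fun h => h0 p (by rw [hk, h, smul_zero])
  have key : ∀ X, (k ^ 2 + k * H) • D f p X + (r * H - k * H) • D g p X = 0 := by
    intro X
    have h1 := D_sub (hw.mul hf.smoothN) (hf.smoothN.mul hw) p X
    have e : (fun q => w q * N q - N q * w q) = fun _ => (0 : ℍ[ℝ]) := funext hc
    have a1 : D f p X * N p = -(N p * D f p X) := by rw [hf.anticomm, neg_neg]
    have a2 : D g p X * N p = -(N p * D g p X) := by rw [hf.anticomm_parallel, neg_neg]
    rw [e, D_const, D_mul hw hf.smoothN, D_mul hf.smoothN hw, hd, hf.D_normal hH, ← hg, hk] at h1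
    simp only [mul_sub, sub_mul, mul_add, add_mul, smul_mul_assoc, mul_smul_comm, mul_assoc, a1,
      a2, hNNx, mul_neg, smul_neg, neg_neg] at h1
    have h2 : (2 : ℝ) • (N p * ((k ^ 2 + k * H) • D f p X + (r * H - k * H) • D g p X)) = 0 := by
      rw [mul_add, mul_smul_comm, mul_smul_comm]
      linear_combination (norm := module) h1
    exact (mul_eq_zero.1 ((smul_eq_zero.1 h2).resolve_left two_ne_zero)).resolve_left hN0
  have k1 := key 1
  have k2 := congrArg (N p * ·) (key (Complex.I * 1))
  have hGI : D g p (Complex.I * 1) = -(N p * D g p 1) := hf.D_parallel_I hH p 1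
  simp only [hf.D_I, hGI, mul_add, mul_smul_comm, mul_neg, hNNx, mul_zero,
    smul_neg, neg_neg] at k2
  have hF := hf.D_ne_zero p one_ne_zero
  have hG : D g p 1 ≠ 0 := fun h => hp ((hf.D_parallel_eq_zero_iff hH p).2 ⟨1, one_ne_zero, h⟩)
  -- Comparing with N times the equation along i separates the types of df and dg, so both
  -- coefficients vanish and r = k = -H.
  have k3 : (2 * (k ^ 2 + k * H)) • D f p 1 = 0 := by
    linear_combination (norm := module) k1 - k2
  have k4 : (2 * (r * H - k * H)) • D g p 1 = 0 := by
    linear_combination (norm := module) k1 + k2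
  have k5 : k * (k + H) = 0 := by linarith [(smul_eq_zero.1 k3).resolve_right hF]
  have k6 : k + H = 0 := (mul_eq_zero.1 k5).resolve_left hk0
  have k7 : (r - k) * H = 0 := by linarith [(smul_eq_zero.1 k4).resolve_right hG]
  have k8 : r - k = 0 := (mul_eq_zero.1 k7).resolve_right hH
  -- For w = kN the first integral reads k² = 2rk + rH♯; r = k = -H forces H♯ = H, the contradiction
  -- sought.
  have h1 := hi p
  rw [hk] at h1
  simp only [smul_mul_assoc, mul_smul_comm, hNN] at h1
  have h2 := congrArg QuaternionAlgebra.re h1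
  simp at h2
  have h3 : r = -H := by linarith
  have h4 : k = -H := by linarith
  rw [h3, h4] at h2
  apply hne
  apply mul_left_cancel₀ hH
  linarith

theorem riccati_of_darboux [PreconnectedSpace M] [Nonempty M] (hf : IsCMCImmersion f N H)
    (hH : H ≠ 0) (hiso : ∀ p, ∀ᶠ q in 𝓝[≠] p, D (parallelSurface f N H) q ≠ 0)
    {fs Ns : M → ℍ[ℝ]} {Hs : ℝ} (hre : ∀ p, (fs p).re = 0) (hd : IsClassicalDarboux f fs)
    (hN : HasMeanCurvature fs Ns Hs) :
    ∃ ρ w, IsRiccati f N H ρ w ∧ ∀ p, fs p = f p + (w p)⁻¹ := by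
  have hT : ∀ p, fs p - f p ≠ 0 := fun p => sub_ne_zero.2 (hd.ne p).symm
  have hw : IsSmooth fun p => (fs p - f p)⁻¹ := (hd.conformal.smooth.sub hf.smooth).inv hT
  have hwre : ∀ p, (fs p - f p)⁻¹.re = 0 := fun p =>
    re_inv_eq_zero (by rw [Quaternion.re_sub, hre, hf.im, sub_zero])
  have hnormal := normal_of_classicalDarboux hf hd hN.1 fun p => inv_mul_cancel₀ (hT p)
  obtain ⟨w, hwd⟩ : ∃ w : M → ℍ[ℝ], w = fun p => (fs p - f p)⁻¹ := ⟨_, rfl⟩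
  have hfs : ∀ p, fs p = f p + (w p)⁻¹ := fun p => by rw [hwd, inv_inv, add_sub_cancel]
  have h0 : ∀ p, w p ≠ 0 := fun p => by rw [hwd]; exact inv_ne_zero (hT p)
  rw [← hwd] at hw
  have hwre' : ∀ p, (w p).re = 0 := fun p => by rw [hwd]; exact hwre p
  rw [show fs = fun p => f p + (w p)⁻¹ from funext hfs] at hN
  obtain ⟨r, hr, h1, h2⟩ := exists_riccati_coefficient hf hH hw hwre' h0 hN fun p => by
    rw [hnormal p, hwd, inv_inv]
  obtain ⟨p₀⟩ := ‹Nonempty M›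
  have hfreq : ∀ p, ∃ᶠ q in 𝓝 p, D (parallelSurface f N H) q ≠ 0 := fun p =>
    have := nhdsNE_neBot p
    frequently_nhds (hiso p)
  have hconst := eq_of_D_eq_zero hr (fun p => D_eq_zero_of_frequently hr
    ((hfreq p).mono fun q hq => D_coefficient_eq_zero hf hH hw hr h1 hq)) p₀
  obtain ⟨q, hq⟩ := (hfreq p₀).exists
  have hr0 : r p₀ ≠ 0 := fun h => hq (by
    ext1 X
    have h3 := h1 q X
    rw [← hconst q, h, zero_smul, zero_add] at h3
    exact (smul_eq_zero.1 h3).resolve_left hH)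
  -- Dividing r(dw - w df w) + H dg = 0 by r turns it into the Riccati equation with ρ = cH.
  obtain ⟨c, hc⟩ : ∃ c, c = -(r p₀)⁻¹ := ⟨_, rfl⟩
  have hc0 : c ≠ 0 := hc ▸ neg_ne_zero.2 (inv_ne_zero hr0)
  have hcr : c * r p₀ = -1 := by rw [hc, neg_mul, inv_mul_cancel₀ hr0]
  have hD : ∀ p X, D w p X = w p * D f p X * w p + (c * H) • D (parallelSurface f N H) p X := by
    intro p X
    have h3 := congrArg (c • ·) (h1 p X)
    simp only [← hconst p, smul_add, smul_smul, hcr, smul_zero] at h3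
    linear_combination (norm := module) -h3
  have hI : ∀ p, w p * w p = c • (w p * N p + N p * w p) - (c * Hs) • 1 := by
    intro p
    have h3 := congrArg (c • ·) (h2 p)
    simp only [← hconst p, smul_smul, hcr] at h3
    linear_combination (norm := module) -h3
  have hHs := meanCurvature_eq hf hH hw hwre' h0 hc0 hD hI hq
  refine ⟨c * H, w, ⟨hw, hwre', h0, mul_ne_zero hc0 hH, hD, fun p => ?_⟩, hfs⟩
  rw [hI, hHs, mul_div_cancel_right₀ _ hH, sub_add_cancel]

end Converse

end CMCDarboux

end

/-! ### The equivalence. -/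

theorem mainTheorem10 {M : Type*} [TopologicalSpace M] [T2Space M] [ChartedSpace ℂ M]
    [IsManifold 𝓘(ℂ, ℂ) ω M] [SimplyConnectedSpace M]
    (f N : M → ℍ[ℝ]) (H : ℝ) (hH : H ≠ 0) (hf : CMCDarboux.IsCMCImmersion f N H)
    (hround : ¬ ∃ (c : ℍ[ℝ]) (ρ : ℝ), c.re = 0 ∧ Set.range f ⊆ Metric.sphere c ρ)
    (F : M → CMCDarboux.HP1) :
    (∃ fs : M → ℍ[ℝ], (∀ p, F p = CMCDarboux.affine (fs p)) ∧ (∀ p, (fs p).re = 0) ∧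
        CMCDarboux.IsClassicalDarboux f fs ∧
        ∃ (Ns : M → ℍ[ℝ]) (Hs : ℝ), CMCDarboux.HasMeanCurvature fs Ns Hs) ↔
      ∃ μ : ℝ, μ ≠ 0 ∧ μ ≠ 1 ∧ CMCDarboux.IsMuDarboux f N (μ : ℂ) F := by
  have hiso := CMCDarboux.isolated_parallel hf hH hround
  constructor
  · rintro ⟨fs, hF, hre, hd, Ns, Hs, hN⟩
    obtain ⟨ρ, w, hw, hfs⟩ := CMCDarboux.riccati_of_darboux hf hH hiso hre hd hN
    rw [show F = fun p => CMCDarboux.affine (f p + (w p)⁻¹) from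
      funext fun p => by rw [hF, hfs]]
    exact hw.isMuDarboux hf hH
  · rintro ⟨μ, h0, h1, hF⟩
    obtain ⟨ρ, w, hw, hFw⟩ := CMCDarboux.riccati_of_parallel hf hH h0 h1 hF
    refine ⟨fun p => f p + (w p)⁻¹, hFw, fun p => ?_, hw.isClassicalDarboux hf hH hiso, _, H,
      hw.hasMeanCurvature hf hH⟩
    rw [Quaternion.re_add, hf.im, CMCDarboux.re_inv_eq_zero (hw.re p), add_zero]
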